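/- Let $p\ge 1$ and $q,n,m\ge 0$ be integers, $X=\mathbb R^p$, $U=\mathbb R^q$, and let $J^k$ be the $k$-th order jet space of $X\times U$, with coordinates $(x,u^{(k)})=(x,(u^\alpha_J)_{|J|\le k,\ 1\le\alpha\le q})$, $J$ ranging over (unordered) multi-indices in $\{1,\dots,p\}$. Let $\Omega\subset X$ be open and let $L_{12}:J^n\times J^m\to\mathbb R$, $L_{12}=L_{12}(x,u^{(n)},y,v^{(m)})$, be smooth (a two-point non-local Lagrangian). Let $L_{21}$ be $L_{12}$ with its two jet arguments exchanged, so that, with $N=\max\{n,m\}$, $$(L_{12}+L_{21})(x,u^{(N)},y,v^{(N)})=L_{12}(x,u^{(n)},y,v^{(m)})+L_{12}(y,v^{(n)},x,u^{(m)}).$$ On smooth functions of finitely many jet coordinates let $$D_i=\frac{\partial}{\partial x^i}+\sum_{\alpha}\sum_J u^\alpha_{J,i}\frac{\partial}{\partial u^\alpha_J},\qquad E_\alpha=\sum_J(-1)^{|J|}D_J\frac{\partial}{\partial u^\alpha_J}\quad(1\le\alpha\le q),\qquad \operatorname{Div}P=D_1P_1+\dots+D_pP_p ,$$ and let $E^1_\alpha,E^2_\alpha$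 be $E_\alpha$ acting on the first, respectively second, jet argument of a two-point function (the other jet being held fixed). A smooth field $\phi:\Omega\to U$ is called admissible if the integral over $\Omega$ of $L_{12}+L_{21}$ along $\phi$, and of its derivatives in the second jet, converges locally uniformly: for every $k\ge 0$ and every compact $K\subset J^{N}$ there is an integrable $g:\Omega\to\mathbb R$ which bounds the norm of the $k$-th derivative of $b\mapsto(L_{12}+L_{21})(x,\phi^{(N)}(x),b)$ at every $b\in K$, for all $x\in\Omega$, where $\phi^{(N)}$ is the $N$-th prolongation of $\phi$. (If $\Omega$ is bounded, every field that is smooth up to the boundary is admissible.) For an admissible field $u=\phi(x)$ put $$\mathcal I^1_\Omega(L_{12}+L_{21})(y,v^{(N)})=\int_\Omega (L_{12}+L_{21})(x,u^{(N)},y,v^{(N)})\,dx .$$ The Lagrangian $L_{12}$ is null on $\Omega$ if the integro-differential Euler-Lagrange equations $$\int_\Omega\left\{E^1_\alpha(L_{12})\left(y,v^{(2n)},x,u^{(m)}\right)+E^2_\alpha(L_{12})\left(x,u^{(n)},y,v^{(2m)}\right)\right\}dx=0,\qquad \alpha=1,\dots,q,$$ hold identically, that is, for every admissible field $u=\phi(x)$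 and all jets $(y,v,\text{derivatives of }v)$ with $y\in\Omega$. **Theorem.** $L_{12}$ is null on $\Omega$ if and only if for every admissible field $u=\phi(x)$ there is a $p$-tuple $P=(P_1,\dots,P_p)$ of smooth functions of $y\in\Omega$, $v$ and finitely many derivatives of $v$ such that $$\mathcal I^1_\Omega(L_{12}+L_{21})=\operatorname{Div}P$$ at all jets $(y,v,\text{derivatives of }v)$ with $y\in\Omega$. -/

import Mathlib

open MeasureTheory
open scoped ContDiff

noncomputable section

namespace NonlocalLagrangian

/-- Multi-indices in `p` variables: `J i` counts how often the index `i` occurs.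
The multi-index `J, i` is `J + Pi.single i 1`. -/
abbrev MultiIndex (p : ℕ) : Type := Fin p → ℕ

/-- The order `|J|` of a multi-index. -/
def absOrder {p : ℕ} (J : MultiIndex p) : ℕ := ∑ i, J i

/-- Multi-indices of order at most `n`. -/
abbrev MultiIndexLE (p n : ℕ) : Type := {J : MultiIndex p // absOrder J ≤ n}

instance (p n : ℕ) : Fintype (MultiIndexLE p n) :=
  Fintype.subtype ((Finset.Iic (fun _ : Fin p => n)).filter (fun J => absOrder J ≤ n)) (by
    intro J
    simp only [Finset.mem_filter, Finset.mem_Iic, and_iff_right_iff_imp]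
    intro h i
    exact (Finset.single_le_sum (f := J) (fun _ _ => Nat.zero_le _) (Finset.mem_univ i)).trans h)

/-- The base space `X = ℝ^p`. -/
abbrev Base (p : ℕ) : Type := Fin p → ℝ

/-- The jet space `J^n` of `X × U`, `U = ℝ^q`, with its coordinates
`(x, (u_J^α))`, `|J| ≤ n`, `α = 1, …, q`. -/
abbrev Jet (p q n : ℕ) : Type := Base p × (MultiIndexLE p n → Fin q → ℝ)

/-- Jets of all orders, with coordinates `(x, (u_J^α)_{J, α})`. It only serves to let differential
operators act without keeping track of orders: every function to which they are applied
factors through some `J^n`. -/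
abbrev JetInf (p q : ℕ) : Type := Base p × (MultiIndex p → Fin q → ℝ)

variable {p q : ℕ}

/-- The projection from jets of all orders to `J^n`. -/
def truncJet (n : ℕ) (z : JetInf p q) : Jet p q n := (z.1, fun J => z.2 J.1)

/-- The projection `J^N → J^n` for `n ≤ N`. -/
def restrictJet {n N : ℕ} (h : n ≤ N) (b : Jet p q N) : Jet p q n :=
  (b.1, fun J => b.2 ⟨J.1, J.2.trans h⟩)

/-- `D_J = D_1^{J_1} ⋯ D_p^{J_p}` for a family of operators `D_1, …, D_p`. -/
def multiIterate {A : Type*} (D : Fin p → A → A) (J : MultiIndex p) (f : A) : A :=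
  (List.finRange p).foldr (fun i g => (D i)^[J i] g) f

/-! ### Prolongation of fields -/

/-- The partial derivative `∂f/∂x^i` of a function on the base. -/
def partialBase (i : Fin p) (f : Base p → ℝ) (x : Base p) : ℝ :=
  lineDeriv ℝ f x (Pi.single i 1)

/-- The prolongation of the field `φ` at `x`: its coordinates are `u_J^α = ∂_J φ^α (x)`. -/
def prolong (φ : Base p → Fin q → ℝ) (x : Base p) : JetInf p q :=
  (x, fun J α => multiIterate partialBase J (fun x' => φ x' α) x)

/-! ### Differential operators on functions of one jet -/

/-- The partial derivative `∂/∂x^i` on functions of a jet. -/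
def partialX (i : Fin p) (F : JetInf p q → ℝ) (z : JetInf p q) : ℝ :=
  lineDeriv ℝ F z (Pi.single i 1, 0)

/-- The partial derivative `∂/∂u_J^α` on functions of a jet. -/
def partialU (J : MultiIndex p) (α : Fin q) (F : JetInf p q → ℝ) (z : JetInf p q) : ℝ :=
  lineDeriv ℝ F z (0, Pi.single J (Pi.single α 1))

/-- The total derivative `D_i = ∂/∂x^i + ∑_α ∑_J u_{J,i}^α ∂/∂u_J^α`. -/
def totalD (i : Fin p) (F : JetInf p q → ℝ) (z : JetInf p q) : ℝ :=
  partialX i F z + ∑ α : Fin q, ∑ᶠ J : MultiIndex p, z.2 (J + Pi.single i 1) α * partialU J α F z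

/-- The component `E_α = ∑_J (-D)_J ∂/∂u_J^α` of the Euler operator. -/
def euler (α : Fin q) (F : JetInf p q → ℝ) (z : JetInf p q) : ℝ :=
  ∑ᶠ J : MultiIndex p, (-1) ^ absOrder J * multiIterate totalD J (partialU J α F) z

/-- The total divergence `Div P = D_1 P_1 + ⋯ + D_p P_p`. -/
def totalDiv (P : Fin p → JetInf p q → ℝ) (z : JetInf p q) : ℝ :=
  ∑ i, totalD i (P i) z

/-! ### Two-point functions -/

/-- The Euler operator `E^1` of the first jet. -/
def euler1 (α : Fin q) (F : JetInf p q → JetInf p q → ℝ) (w z : JetInf p q) : ℝ :=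
  euler α (fun w' => F w' z) w

/-- The Euler operator `E^2` of the second jet. -/
def euler2 (α : Fin q) (F : JetInf p q → JetInf p q → ℝ) (w z : JetInf p q) : ℝ :=
  euler α (fun z' => F w z') z

/-- A Lagrangian on `J^n × J^m`, read as a function of two jets of arbitrary order. -/
def liftInf {n m : ℕ} (L : Jet p q n × Jet p q m → ℝ) (w z : JetInf p q) : ℝ :=
  L (truncJet n w, truncJet m z)

/-- The symmetrisation `L₁₂ + L₂₁` on `J^N × J^N`, `N = max n m`, where `L₂₁` is `L₁₂` with its
two jets exchanged. -/
def symmetrised {n m : ℕ} (L : Jet p q n × Jet p q m → ℝ)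
    (c : Jet p q (max n m) × Jet p q (max n m)) : ℝ :=
  L (restrictJet (le_max_left n m) c.1, restrictJet (le_max_right n m) c.2) +
    L (restrictJet (le_max_left n m) c.2, restrictJet (le_max_right n m) c.1)

/-- The integral `I^1_Ω(f)` over the first point along the field `u = φ(x)`, as a function of
the second jet. -/
def integral1 (Ω : Set (Base p)) (φ : Base p → Fin q → ℝ)
    (F : JetInf p q → JetInf p q → ℝ) (z : JetInf p q) : ℝ :=
  ∫ x in Ω, F (prolong φ x) z

/-- Smooth fields `φ : Ω → U` for which the integral over `Ω` of `L₁₂ + L₂₁` along `φ` and of its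
derivatives in the second jet converges, locally uniformly in the second jet. If `Ω` is bounded
and `φ` is smooth up to the boundary, this is automatic. -/
structure IsAdmissible {n m : ℕ} (Ω : Set (Base p)) (L : Jet p q n × Jet p q m → ℝ)
    (φ : Base p → Fin q → ℝ) : Prop where
  smooth : ContDiffOn ℝ ∞ φ Ω
  dominated : ∀ (k : ℕ) (K : Set (Jet p q (max n m))), IsCompact K →
    ∃ g : Base p → ℝ, IntegrableOn g Ω ∧ ∀ x ∈ Ω, ∀ b ∈ K,
      ‖iteratedFDeriv ℝ k (fun b' => symmetrised L (truncJet (max n m) (prolong φ x), b')) b‖ ≤ g x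

/-- `L₁₂` is null on `Ω`: the Euler-Lagrange equations
`∫_Ω {E^1(L₁₂)(y, v, x, u) + E^2(L₁₂)(x, u, y, v)} dx = 0` (one for each component of the field)
hold for all fields `u = φ(x)` and all jets `(y, v)` over points `y ∈ Ω`. -/
def IsNullOn {n m : ℕ} (Ω : Set (Base p)) (L : Jet p q n × Jet p q m → ℝ) : Prop :=
  ∀ φ : Base p → Fin q → ℝ, IsAdmissible Ω L φ →
    ∀ α : Fin q, ∀ z : JetInf p q, z.1 ∈ Ω →
      ∫ x in Ω, (euler1 α (liftInf L) z (prolong φ x) + euler2 α (liftInf L) (prolong φ x) z) = 0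

end NonlocalLagrangian

end

open NonlocalLagrangian

noncomputable section

namespace NonlocalLagrangian

variable {p q : ℕ}

/-! ### Functions of finitely many jet coordinates -/

/-! Fix an admissible field `φ` and let `G` be the integral of the symmetrised Lagrangian along `φ`,
a function of the second jet alone. The domination hypothesis makes `G` smooth in finitely many jet
coordinates and lets every operator built from directional derivatives pass under the integral.
Since the second-jet Euler operator applied to `L₁₂ + L₂₁` is the sum of the two terms in the
nullity condition, the left side of that condition is exactly `E_α G`
(`IsAdmissible.euler_integral1`). What remains is the local statement that, over `Ω`, `E_α G = 0`
for all `α` if and only if `G` is a total divergence.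

Divergences are killed because the commutator of `∂/∂u_J` with `D_i` is `∂/∂u_{J-i}`, which makes
the alternating sum `E_α D_i F` telescope (`euler_totalD`). A `P` that is smooth only over `Ω` is
first cut off in the base variable (`euler_eq_zero_of_eq_totalDiv`).

For the converse, integration by parts gives the first variation `∑ u_J ∂G/∂u_J = ∑ u E(G) + Div A`
(`IsSmoothJetFun.exists_first_variation`). Along the fibre ray `(x, su)` the Euler term drops out,
and `A (x, su)` is divisible by `s`, so integrating over `0 < s ≤ 1` writes `G (x, u) - G (x, 0)` as
a divergence. The remainder `G (x, 0)` is integrated in one coordinate direction, which needs `p ≥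
1` (`IsSmoothJetFun.exists_totalDiv_of_euler_eq_zero`). No shape condition on `Ω` appears: scaling
fixes the base point, and `G` is smooth over the whole of `ℝ^p`. -/

/-- Smooth functions of `x`, `u` and finitely many derivatives of `u`. -/
def IsSmoothJetFun (F : JetInf p q → ℝ) : Prop :=
  ∃ (N : ℕ) (f : Jet p q N → ℝ), ContDiff ℝ ∞ f ∧ F = fun z => f (truncJet N z)

lemma contDiff_restrictJet {n N : ℕ} (h : n ≤ N) {k : ℕ∞ω} :
    ContDiff ℝ k (restrictJet h : Jet p q N → Jet p q n) := by
  unfold restrictJet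
  fun_prop

lemma truncJet_add_smul (N : ℕ) (z v : JetInf p q) (t : ℝ) :
    truncJet N (z + t • v) = truncJet N z + t • truncJet N v := rfl

lemma truncJet_single_of_lt {N : ℕ} {J : MultiIndex p} (h : N < absOrder J) (v : Fin q → ℝ) :
    truncJet N ((0, Pi.single J v) : JetInf p q) = 0 := by
  refine Prod.ext rfl (funext fun K => ?_)
  have : K.1 ≠ J := fun e => by have := K.2; rw [e] at this; omega
  simp [truncJet, this]

lemma IsSmoothJetFun.exists_rep_ge {F : JetInf p q → ℝ} (hF : IsSmoothJetFun F) (M : ℕ) :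
    ∃ (N : ℕ) (f : Jet p q N → ℝ), M ≤ N ∧ ContDiff ℝ ∞ f ∧ F = fun z => f (truncJet N z) := by
  obtain ⟨N, f, hf, rfl⟩ := hF
  exact ⟨max M N, fun b => f (restrictJet (le_max_right M N) b), le_max_left _ _,
    hf.comp (contDiff_restrictJet _), rfl⟩

lemma IsSmoothJetFun.exists_rep_pair {F G : JetInf p q → ℝ} (hF : IsSmoothJetFun F)
    (hG : IsSmoothJetFun G) :
    ∃ (N : ℕ) (f g : Jet p q N → ℝ), ContDiff ℝ ∞ f ∧ ContDiff ℝ ∞ g ∧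
      (F = fun z => f (truncJet N z)) ∧ G = fun z => g (truncJet N z) := by
  obtain ⟨N, f, hf, rfl⟩ := hF
  obtain ⟨M, g, hNM, hg, rfl⟩ := hG.exists_rep_ge N
  exact ⟨M, fun b => f (restrictJet hNM b), g, hf.comp (contDiff_restrictJet _), hg, rfl, rfl⟩

lemma IsSmoothJetFun.add {F G : JetInf p q → ℝ} (hF : IsSmoothJetFun F)
    (hG : IsSmoothJetFun G) : IsSmoothJetFun (fun z => F z + G z) := by
  obtain ⟨N, f, g, hf, hg, rfl, rfl⟩ := hF.exists_rep_pair hG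
  exact ⟨N, fun b => f b + g b, hf.add hg, rfl⟩

lemma IsSmoothJetFun.mul {F G : JetInf p q → ℝ} (hF : IsSmoothJetFun F)
    (hG : IsSmoothJetFun G) : IsSmoothJetFun (fun z => F z * G z) := by
  obtain ⟨N, f, g, hf, hg, rfl, rfl⟩ := hF.exists_rep_pair hG
  exact ⟨N, fun b => f b * g b, hf.mul hg, rfl⟩

lemma isSmoothJetFun_const (c : ℝ) : IsSmoothJetFun (fun _ : JetInf p q => c) :=
  ⟨0, fun _ => c, contDiff_const, rfl⟩

lemma IsSmoothJetFun.const_mul {F : JetInf p q → ℝ} (hF : IsSmoothJetFun F) (c : ℝ) :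
    IsSmoothJetFun (fun z => c * F z) :=
  (isSmoothJetFun_const c).mul hF

lemma isSmoothJetFun_coord (J : MultiIndex p) (α : Fin q) :
    IsSmoothJetFun (fun z : JetInf p q => z.2 J α) :=
  ⟨absOrder J, fun b => b.2 ⟨J, le_rfl⟩ α, by fun_prop, rfl⟩

lemma isSmoothJetFun_finset_sum {ι : Type*} (s : Finset ι) {F : ι → JetInf p q → ℝ}
    (hF : ∀ i ∈ s, IsSmoothJetFun (F i)) : IsSmoothJetFun (fun z => ∑ i ∈ s, F i z) := by
  classical
  induction s using Finset.induction_on with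
  | empty => simpa using isSmoothJetFun_const 0
  | insert a s ha ih =>
    simp only [Finset.sum_insert ha]
    exact (hF a (by simp)).add (ih fun i hi => hF i (by simp [hi]))

/-! ### Directional derivatives -/

/-- Truncation is linear, so it carries lines to lines definitionally. All calculus on the infinite
product thereby reduces to Fréchet derivatives on the finite-dimensional `J^N`. -/
lemma lineDeriv_comp_truncJet {N : ℕ} {f : Jet p q N → ℝ} {z : JetInf p q}
    (hf : DifferentiableAt ℝ f (truncJet N z)) (v : JetInf p q) :
    lineDeriv ℝ (fun z => f (truncJet N z)) z v =
      fderiv ℝ f (truncJet N z) (truncJet N v) :=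
  (show lineDeriv ℝ (fun z => f (truncJet N z)) z v =
    lineDeriv ℝ f (truncJet N z) (truncJet N v) from rfl).trans hf.lineDeriv_eq_fderiv

lemma finsum_multiIndex_eq_sum {M : Type*} [AddCommMonoid M] (N : ℕ) {f : MultiIndex p → M}
    (h : ∀ J, N < absOrder J → f J = 0) : ∑ᶠ J, f J = ∑ J : MultiIndexLE p N, f J.1 := by
  classical
  rw [finsum_eq_sum_of_support_subset (s := Finset.univ.map (Function.Embedding.subtype
    (fun J : MultiIndex p => absOrder J ≤ N))) f, Finset.sum_map]
  · rfl
  · intro J hJ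
    have : absOrder J ≤ N := not_lt.1 fun hlt => hJ (h J hlt)
    simpa using this

/-- Functions on multi-indices which vanish for large orders have finite support. -/
lemma finite_support_of_absOrder {M : Type*} [Zero M] (N : ℕ) {f : MultiIndex p → M}
    (h : ∀ J, N < absOrder J → f J = 0) : (Function.support f).Finite := by
  refine (Set.toFinite (Set.range (Subtype.val : MultiIndexLE p N → MultiIndex p))).subset ?_
  intro J hJ
  exact ⟨⟨J, not_lt.1 fun hlt => hJ (h J hlt)⟩, rfl⟩

lemma partialU_eq_zero_of_lt {N : ℕ} (f : Jet p q N → ℝ) {J : MultiIndex p}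
    (hJ : N < absOrder J) (α : Fin q) :
    partialU J α (fun z => f (truncJet N z)) = 0 := by
  funext z
  simp only [partialU, lineDeriv, truncJet_add_smul, truncJet_single_of_lt hJ, smul_zero,
    deriv_const, Pi.zero_apply]

lemma IsSmoothJetFun.exists_partialU_eq_zero {F : JetInf p q → ℝ} (hF : IsSmoothJetFun F) :
    ∃ N, ∀ J, N < absOrder J → ∀ α, partialU J α F = 0 := by
  obtain ⟨N, f, -, rfl⟩ := hF
  exact ⟨N, fun J hJ α => partialU_eq_zero_of_lt f hJ α⟩

lemma sum_smul_truncJet_single (N : ℕ) (w : MultiIndex p → Fin q → ℝ) :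
    ∑ α : Fin q, ∑ J : MultiIndexLE p N,
      w J.1 α • truncJet N ((0, Pi.single J.1 (Pi.single α 1)) : JetInf p q) =
      truncJet N (0, w) := by
  refine Prod.ext ?_ (funext fun K => funext fun β => ?_)
  · simp [Prod.fst_sum, truncJet]
  · simp only [Prod.snd_sum, Finset.sum_apply, truncJet, Prod.smul_snd, Pi.smul_apply, smul_eq_mul]
    rw [Finset.sum_eq_single β, Finset.sum_eq_single K]
    · simp
    · intro J _ hJ
      have : K.1 ≠ J.1 := fun e => hJ (Subtype.ext e.symm)
      simp [this]
    · simp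
    · intro α _ hα
      refine Finset.sum_eq_zero fun J _ => ?_
      by_cases h : K.1 = J.1
      · simp [h, hα.symm]
      · simp [h]
    · simp

/-- Only finitely many coordinates matter, so linearity of the derivative collapses the formal sum.
This serves twice: for the fibre part of `D_i` and for the Euler field `∑ u_J ∂/∂u_J`. -/
lemma IsSmoothJetFun.sum_mul_partialU {F : JetInf p q → ℝ} (hF : IsSmoothJetFun F)
    (w : MultiIndex p → Fin q → ℝ) (z : JetInf p q) :
    ∑ α : Fin q, ∑ᶠ J : MultiIndex p, w J α * partialU J α F z = lineDeriv ℝ F z (0, w) := by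
  obtain ⟨N, f, hf, rfl⟩ := hF
  have hd : DifferentiableAt ℝ f (truncJet N z) := hf.differentiable (by simp) _
  rw [lineDeriv_comp_truncJet hd, ← sum_smul_truncJet_single, map_sum]
  refine Finset.sum_congr rfl fun α _ => ?_
  rw [finsum_multiIndex_eq_sum N (fun J hJ => by simp [partialU_eq_zero_of_lt f hJ]), map_sum]
  refine Finset.sum_congr rfl fun J _ => ?_
  rw [partialU, lineDeriv_comp_truncJet hd, map_smul, smul_eq_mul]

lemma IsSmoothJetFun.lineDeriv_add_vec {F : JetInf p q → ℝ} (hF : IsSmoothJetFun F)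
    (z v w : JetInf p q) : lineDeriv ℝ F z (v + w) = lineDeriv ℝ F z v + lineDeriv ℝ F z w := by
  obtain ⟨N, f, hf, rfl⟩ := hF
  have hd : DifferentiableAt ℝ f (truncJet N z) := hf.differentiable (by simp) _
  simp only [lineDeriv_comp_truncJet hd]
  exact map_add (fderiv ℝ f (truncJet N z)) (truncJet N v) (truncJet N w)

/-- The vector field on the jet space whose directional derivative is `D_i`. -/
def totalField (i : Fin p) (z : JetInf p q) : JetInf p q :=
  (Pi.single i 1, fun J => z.2 (J + Pi.single i 1))

lemma IsSmoothJetFun.totalD_eq {F : JetInf p q → ℝ} (hF : IsSmoothJetFun F) (i : Fin p) :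
    totalD i F = fun z => lineDeriv ℝ F z (totalField i z) := by
  funext z
  refine (congrArg (partialX i F z + ·)
    (hF.sum_mul_partialU (fun J => z.2 (J + Pi.single i 1)) z)).trans ?_
  simp only [partialX, ← hF.lineDeriv_add_vec]
  simp [totalField]

/-- Vector fields on jets with smooth components depending on finitely many coordinates. -/
def IsSmoothJetField (V : JetInf p q → JetInf p q) : Prop :=
  -- `N ≤ M` ensures that the base point of a function of order `N` and the value of the field are
  -- both determined by the `M`-jet.
  ∀ N : ℕ, ∃ (M : ℕ) (_ : N ≤ M) (W : Jet p q M → Jet p q N), ContDiff ℝ ∞ W ∧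
    ∀ z, truncJet N (V z) = W (truncJet M z)

lemma isSmoothJetField_const (v : JetInf p q) : IsSmoothJetField (fun _ => v) :=
  fun N => ⟨N, le_rfl, fun _ => truncJet N v, contDiff_const, fun _ => rfl⟩

lemma absOrder_add_single (J : MultiIndex p) (i : Fin p) :
    absOrder (J + Pi.single i 1) = absOrder J + 1 := by
  simp [absOrder, Finset.sum_add_distrib]

lemma isSmoothJetField_totalField (i : Fin p) :
    IsSmoothJetField (totalField i : JetInf p q → JetInf p q) := by
  refine fun N => ⟨N + 1, Nat.le_succ N, fun b => (Pi.single i 1, fun J =>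
    b.2 ⟨J.1 + Pi.single i 1, by rw [absOrder_add_single]; exact Nat.succ_le_succ J.2⟩), ?_,
    fun _ => rfl⟩
  fun_prop

lemma IsSmoothJetFun.lineDeriv {F : JetInf p q → ℝ} (hF : IsSmoothJetFun F)
    {V : JetInf p q → JetInf p q} (hV : IsSmoothJetField V) :
    IsSmoothJetFun (fun z => lineDeriv ℝ F z (V z)) := by
  obtain ⟨N, f, hf, rfl⟩ := hF
  obtain ⟨M, hNM, W, hW, hVW⟩ := hV N
  refine ⟨M, fun b => fderiv ℝ f (restrictJet hNM b) (W b), ?_, ?_⟩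
  · exact ((hf.fderiv_right (m := ∞) (by simp)).comp (contDiff_restrictJet hNM)).clm_apply hW
  · funext z
    rw [lineDeriv_comp_truncJet (hf.differentiable (by simp) _), hVW]
    rfl

lemma IsSmoothJetFun.partialU {F : JetInf p q → ℝ} (hF : IsSmoothJetFun F) (J : MultiIndex p)
    (α : Fin q) : IsSmoothJetFun (partialU J α F) :=
  hF.lineDeriv (isSmoothJetField_const _)

lemma IsSmoothJetFun.totalD {F : JetInf p q → ℝ} (hF : IsSmoothJetFun F) (i : Fin p) :
    IsSmoothJetFun (totalD i F) := by
  rw [hF.totalD_eq]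
  exact hF.lineDeriv (isSmoothJetField_totalField i)

/-! ### Linearity and the Leibniz rule -/

lemma IsSmoothJetFun.lineDifferentiableAt {F : JetInf p q → ℝ} (hF : IsSmoothJetFun F)
    (z v : JetInf p q) : LineDifferentiableAt ℝ F z v := by
  obtain ⟨N, f, hf, rfl⟩ := hF
  exact ((hf.differentiable (by simp) (truncJet N z)).lineDifferentiableAt :
    LineDifferentiableAt ℝ f (truncJet N z) (truncJet N v))

lemma IsSmoothJetFun.lineDeriv_add {F G : JetInf p q → ℝ} (hF : IsSmoothJetFun F)
    (hG : IsSmoothJetFun G) (z v : JetInf p q) :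
    _root_.lineDeriv ℝ (fun z => F z + G z) z v =
      _root_.lineDeriv ℝ F z v + _root_.lineDeriv ℝ G z v :=
  deriv_fun_add (hF.lineDifferentiableAt z v) (hG.lineDifferentiableAt z v)

lemma IsSmoothJetFun.lineDeriv_const_mul {F : JetInf p q → ℝ} (hF : IsSmoothJetFun F)
    (c : ℝ) (z v : JetInf p q) :
    _root_.lineDeriv ℝ (fun z => c * F z) z v = c * _root_.lineDeriv ℝ F z v :=
  deriv_const_mul c (hF.lineDifferentiableAt z v)

lemma IsSmoothJetFun.lineDeriv_mul {F G : JetInf p q → ℝ} (hF : IsSmoothJetFun F)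
    (hG : IsSmoothJetFun G) (z v : JetInf p q) :
    _root_.lineDeriv ℝ (fun z => F z * G z) z v =
      _root_.lineDeriv ℝ F z v * G z + F z * _root_.lineDeriv ℝ G z v := by
  have := deriv_fun_mul (hF.lineDifferentiableAt z v) (hG.lineDifferentiableAt z v)
  simpa [_root_.lineDeriv] using this

lemma IsSmoothJetFun.totalD_add {F G : JetInf p q → ℝ} (hF : IsSmoothJetFun F)
    (hG : IsSmoothJetFun G) (i : Fin p) :
    NonlocalLagrangian.totalD i (fun z => F z + G z) =
      fun z => NonlocalLagrangian.totalD i F z + NonlocalLagrangian.totalD i G z := by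
  rw [(hF.add hG).totalD_eq, hF.totalD_eq, hG.totalD_eq]
  exact funext fun z => hF.lineDeriv_add hG z _

lemma IsSmoothJetFun.totalD_const_mul {F : JetInf p q → ℝ} (hF : IsSmoothJetFun F) (c : ℝ)
    (i : Fin p) :
    NonlocalLagrangian.totalD i (fun z => c * F z) =
      fun z => c * NonlocalLagrangian.totalD i F z := by
  rw [(hF.const_mul c).totalD_eq, hF.totalD_eq]
  exact funext fun z => hF.lineDeriv_const_mul c z _

lemma IsSmoothJetFun.totalD_mul {F G : JetInf p q → ℝ} (hF : IsSmoothJetFun F)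
    (hG : IsSmoothJetFun G) (i : Fin p) :
    NonlocalLagrangian.totalD i (fun z => F z * G z) =
      fun z => NonlocalLagrangian.totalD i F z * G z + F z * NonlocalLagrangian.totalD i G z := by
  rw [(hF.mul hG).totalD_eq, hF.totalD_eq, hG.totalD_eq]
  exact funext fun z => hF.lineDeriv_mul hG z _

lemma totalD_coord (i : Fin p) (J : MultiIndex p) (α : Fin q) :
    totalD i (fun z : JetInf p q => z.2 J α) = fun z => z.2 (J + Pi.single i 1) α := by
  rw [(isSmoothJetFun_coord J α).totalD_eq]
  funext z
  have : HasDerivAt (fun t : ℝ => z.2 J α + t * z.2 (J + Pi.single i 1) α)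
      (z.2 (J + Pi.single i 1) α) 0 := by
    simpa using ((hasDerivAt_id (0 : ℝ)).mul_const (z.2 (J + Pi.single i 1) α)).const_add (z.2 J α)
  exact this.deriv

/-! ### Commutators -/

/-- All commutators come from this formula: the Hessian term is symmetric and cancels, leaving only
the derivative along the variation `v` of the field. -/
lemma lineDeriv_lineDeriv {N : ℕ} {f : Jet p q N → ℝ} (hf : ContDiff ℝ ∞ f)
    {V : JetInf p q → JetInf p q} {z w v : JetInf p q} (hV : ∀ t : ℝ, V (z + t • w) = V z + t • v) :
    lineDeriv ℝ (fun z => lineDeriv ℝ (fun z => f (truncJet N z)) z (V z)) z w =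
      fderiv ℝ (fderiv ℝ f) (truncJet N z) (truncJet N w) (truncJet N (V z)) +
        fderiv ℝ f (truncJet N z) (truncJet N v) := by
  have hd : Differentiable ℝ f := hf.differentiable (by simp)
  have hd2 : Differentiable ℝ (fderiv ℝ f) :=
    (hf.fderiv_right (m := ∞) (by simp)).differentiable (by simp)
  simp only [lineDeriv_comp_truncJet (hd _)]
  have hline (a b : Jet p q N) : HasDerivAt (fun t : ℝ => a + t • b) b 0 := by
    simpa using ((hasDerivAt_id (0 : ℝ)).smul_const b).const_add a
  have h1 : HasDerivAt (fun t : ℝ => fderiv ℝ f (truncJet N z + t • truncJet N w))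
      (fderiv ℝ (fderiv ℝ f) (truncJet N z) (truncJet N w)) 0 := by
    refine HasFDerivAt.comp_hasDerivAt (0 : ℝ) ?_ (hline _ _)
    simpa using (hd2 (truncJet N z)).hasFDerivAt
  have h2 := h1.clm_apply (hline (truncJet N (V z)) (truncJet N v))
  have h3 := h2.deriv
  simp only [zero_smul, add_zero] at h3
  rw [← h3, lineDeriv]
  simp only [hV, truncJet_add_smul]

lemma two_le_infty : minSmoothness ℝ 2 ≤ (∞ : ℕ∞ω) := by
  simpa using WithTop.coe_le_coe.2 (le_top : (2 : ℕ∞) ≤ ⊤)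

lemma IsSmoothJetFun.totalD_comm {F : JetInf p q → ℝ} (hF : IsSmoothJetFun F) (i j : Fin p) :
    NonlocalLagrangian.totalD i (NonlocalLagrangian.totalD j F) =
      NonlocalLagrangian.totalD j (NonlocalLagrangian.totalD i F) := by
  rw [(hF.totalD j).totalD_eq, (hF.totalD i).totalD_eq, hF.totalD_eq, hF.totalD_eq]
  obtain ⟨N, f, hf, rfl⟩ := hF
  funext z
  have key (i j : Fin p) : ∀ t : ℝ, totalField j (z + t • totalField i z) = totalField j z +
      t • (0, fun J => z.2 (J + Pi.single j 1 + Pi.single i 1)) := by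
    intro t
    refine Prod.ext ?_ ?_ <;> simp [totalField]
    rfl
  rw [lineDeriv_lineDeriv hf (key i j), lineDeriv_lineDeriv hf (key j i)]
  congr 1
  · exact (hf.contDiffAt.isSymmSndFDerivAt two_le_infty).eq _ _
  · simp only [add_right_comm]

/-- The coefficient `u_{K,i}` of `D_i` varies with `u_J` exactly when `K + i = J`. Such a `K` exists
only if `i` occurs in `J`, hence the case distinction. -/
lemma IsSmoothJetFun.partialU_totalD {F : JetInf p q → ℝ} (hF : IsSmoothJetFun F)
    (J : MultiIndex p) (α : Fin q) (i : Fin p) :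
    NonlocalLagrangian.partialU J α (NonlocalLagrangian.totalD i F) =
      fun z => NonlocalLagrangian.totalD i (NonlocalLagrangian.partialU J α F) z +
        if 0 < J i then NonlocalLagrangian.partialU (J - Pi.single i 1) α F z else 0 := by
  rw [(hF.partialU J α).totalD_eq, hF.totalD_eq]
  obtain ⟨N, f, hf, rfl⟩ := hF
  funext z
  have h1 : ∀ t : ℝ, totalField i (z + t • ((0, Pi.single J (Pi.single α 1)) : JetInf p q)) =
      totalField i z + t • (0, fun K => (Pi.single J (Pi.single α 1) : MultiIndex p → Fin q → ℝ)
        (K + Pi.single i 1)) := by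
    intro t
    refine Prod.ext ?_ ?_ <;> simp [totalField]
    rfl
  unfold NonlocalLagrangian.partialU
  have h3 := lineDeriv_lineDeriv hf (V := fun _ => ((0, Pi.single J (Pi.single α 1)) :
    JetInf p q)) (z := z) (w := totalField i z) (v := 0) (by simp)
  beta_reduce at h3 ⊢
  rw [lineDeriv_lineDeriv hf h1, h3,
    (hf.contDiffAt.isSymmSndFDerivAt two_le_infty).eq, add_assoc]
  congr 1
  have h0 : truncJet N (0 : JetInf p q) = 0 := rfl
  rw [h0, map_zero, zero_add]
  split_ifs with hJ
  · rw [lineDeriv_comp_truncJet (hf.differentiable (by simp) _)]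
    congr 3
    funext K
    have : K + Pi.single i 1 = J ↔ K = J - Pi.single i 1 := by
      constructor
      · rintro rfl; simp
      · rintro rfl
        funext k
        by_cases hk : k = i
        · subst hk; simp; omega
        · simp [hk]
    by_cases hK : K = J - Pi.single i 1
    · rw [this.2 hK, hK]; simp
    · rw [Pi.single_eq_of_ne (fun e => hK (this.1 e)), Pi.single_eq_of_ne hK]
  · have : (fun K : MultiIndex p => (Pi.single J (Pi.single α 1) : MultiIndex p → Fin q → ℝ)
        (K + Pi.single i 1)) = 0 := by
      funext K
      refine Pi.single_eq_of_ne (fun e => hJ ?_) _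
      rw [← e]; simp
    rw [this]
    exact map_zero (fderiv ℝ f (truncJet N z))

/-! ### Iterated operators -/

section MultiIterate

variable {A B C : Type*}

/-- A parametricity principle: whatever relation survives one application of each operator survives
the iterates. Linearity, closure properties, locality and exchange with integrals are all obtained
from it. -/
lemma multiIterate_rel {R : A → B → C → Prop} {D₁ : Fin p → A → A} {D₂ : Fin p → B → B}
    {D₃ : Fin p → C → C} (hR : ∀ i f g h, R f g h → R (D₁ i f) (D₂ i g) (D₃ i h))
    (J : MultiIndex p) {f : A} {g : B} {h : C} (hfgh : R f g h) :
    R (multiIterate D₁ J f) (multiIterate D₂ J g) (multiIterate D₃ J h) := by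
  have hiter : ∀ (k : ℕ) (i : Fin p) f g h, R f g h →
      R ((D₁ i)^[k] f) ((D₂ i)^[k] g) ((D₃ i)^[k] h) := by
    intro k i
    induction k with
    | zero => exact fun _ _ _ h => h
    | succ k ih => exact fun f g h hr => ih _ _ _ (hR i f g h hr)
  unfold multiIterate
  induction List.finRange p with
  | nil => exact hfgh
  | cons i l ih => exact hiter _ _ _ _ _ ih

lemma multiIterate_rel₂ {R : A → B → Prop} {D₁ : Fin p → A → A} {D₂ : Fin p → B → B}
    (hR : ∀ i f g, R f g → R (D₁ i f) (D₂ i g)) (J : MultiIndex p) {f : A} {g : B} (h : R f g) :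
    R (multiIterate D₁ J f) (multiIterate D₂ J g) :=
  multiIterate_rel (R := fun f g (_ : Unit) => R f g) (D₃ := fun _ => id)
    (fun i f g _ => hR i f g) J (h := ()) h

lemma multiIterate_induction {S : A → Prop} {D : Fin p → A → A} (hS : ∀ i f, S f → S (D i f))
    (J : MultiIndex p) {f : A} (h : S f) : S (multiIterate D J f) :=
  multiIterate_rel₂ (R := fun f (_ : Unit) => S f) (D₂ := fun _ => id)
    (fun i f _ => hS i f) J (g := ()) h

@[simp] lemma multiIterate_zero (D : Fin p → A → A) (f : A) : multiIterate D 0 f = f := by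
  unfold multiIterate
  induction List.finRange p with
  | nil => rfl
  | cons i l ih => simp

/-- `multiIterate` applies the operators in a fixed order, so the extra `D i` must be moved through
the others. The predicate `S` is present because total derivatives are known to commute only on
smooth jet functions. -/
lemma multiIterate_add_single {S : A → Prop} {D : Fin p → A → A} (hS : ∀ i f, S f → S (D i f))
    (hD : ∀ i j f, S f → D i (D j f) = D j (D i f)) (J : MultiIndex p) (i : Fin p) {f : A}
    (hf : S f) : multiIterate D (J + Pi.single i 1) f = multiIterate D J (D i f) := by
  have hSk : ∀ (k : ℕ) (j : Fin p) f, S f → S ((D j)^[k] f) := by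
    intro k j
    induction k with
    | zero => exact fun _ h => h
    | succ k ih => exact fun f h => ih _ (hS j f h)
  have hDk : ∀ (k : ℕ) (j : Fin p) f, S f → D i ((D j)^[k] f) = (D j)^[k] (D i f) := by
    intro k j
    induction k with
    | zero => exact fun _ _ => rfl
    | succ k ih => intro f h; simp only [Function.iterate_succ_apply, ih _ (hS j f h), hD i j f h]
  have hSl : ∀ l : List (Fin p), S (l.foldr (fun i g => (D i)^[J i] g) f) := by
    intro l
    induction l with
    | nil => exact hf
    | cons j l ih => exact hSk _ _ _ ih
  have hcomm : ∀ l : List (Fin p), D i (l.foldr (fun i g => (D i)^[J i] g) f) =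
      l.foldr (fun i g => (D i)^[J i] g) (D i f) := by
    intro l
    induction l with
    | nil => rfl
    | cons j l ih => simp only [List.foldr_cons]; rw [hDk _ _ _ (hSl l), ih]
  have hnot : ∀ l : List (Fin p), i ∉ l →
      l.foldr (fun j g => (D j)^[(J + Pi.single i 1 : MultiIndex p) j] g) f =
        l.foldr (fun i g => (D i)^[J i] g) f := by
    intro l
    induction l with
    | nil => exact fun _ => rfl
    | cons j l ih =>
      intro h
      simp only [List.mem_cons, not_or] at h
      simp only [List.foldr_cons]
      rw [ih h.2]
      simp [Ne.symm h.1]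
  have hmem : ∀ l : List (Fin p), i ∈ l → l.Nodup →
      l.foldr (fun j g => (D j)^[(J + Pi.single i 1 : MultiIndex p) j] g) f =
        l.foldr (fun i g => (D i)^[J i] g) (D i f) := by
    intro l
    induction l with
    | nil => simp
    | cons j l ih =>
      intro h hl
      rw [List.nodup_cons] at hl
      simp only [List.foldr_cons]
      by_cases hij : i = j
      · subst hij
        rw [hnot l hl.1, ← hcomm]
        simp
      · rw [ih (by simpa [hij] using h) hl.2]
        simp [Ne.symm hij]
  exact hmem _ (List.mem_finRange i) (List.nodup_finRange p)

end MultiIterate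

lemma IsSmoothJetFun.multiIterate_totalD {F : JetInf p q → ℝ} (hF : IsSmoothJetFun F)
    (J : MultiIndex p) : IsSmoothJetFun (multiIterate NonlocalLagrangian.totalD J F) :=
  multiIterate_induction (S := IsSmoothJetFun) (fun i _ h => IsSmoothJetFun.totalD h i) J hF

lemma IsSmoothJetFun.multiIterate_totalD_add_single {F : JetInf p q → ℝ} (hF : IsSmoothJetFun F)
    (J : MultiIndex p) (i : Fin p) :
    multiIterate NonlocalLagrangian.totalD (J + Pi.single i 1) F =
      multiIterate NonlocalLagrangian.totalD J (NonlocalLagrangian.totalD i F) :=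
  multiIterate_add_single (fun i _ h => IsSmoothJetFun.totalD h i)
    (fun i j _ h => h.totalD_comm i j) J i hF

lemma IsSmoothJetFun.multiIterate_totalD_add {F G : JetInf p q → ℝ} (hF : IsSmoothJetFun F)
    (hG : IsSmoothJetFun G) (J : MultiIndex p) :
    multiIterate NonlocalLagrangian.totalD J (fun z => F z + G z) =
      fun z => multiIterate NonlocalLagrangian.totalD J F z +
        multiIterate NonlocalLagrangian.totalD J G z :=
  (multiIterate_rel (R := fun f g h => IsSmoothJetFun f ∧ IsSmoothJetFun g ∧
      h = fun z => f z + g z)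
    (by
      rintro i f g h ⟨hf, hg, rfl⟩
      exact ⟨hf.totalD i, hg.totalD i, hf.totalD_add hg i⟩) J ⟨hF, hG, rfl⟩).2.2

lemma IsSmoothJetFun.multiIterate_totalD_const_mul {F : JetInf p q → ℝ} (hF : IsSmoothJetFun F)
    (c : ℝ) (J : MultiIndex p) :
    multiIterate NonlocalLagrangian.totalD J (fun z => c * F z) =
      fun z => c * multiIterate NonlocalLagrangian.totalD J F z :=
  (multiIterate_rel₂ (R := fun f g => IsSmoothJetFun f ∧ g = fun z => c * f z)
    (by
      rintro i f g ⟨hf, rfl⟩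
      exact ⟨hf.totalD i, hf.totalD_const_mul c i⟩) J ⟨hF, rfl⟩).2

lemma multiIterate_totalD_zero (J : MultiIndex p) :
    multiIterate totalD J (0 : JetInf p q → ℝ) = 0 := by
  have h := (isSmoothJetFun_const (p := p) (q := q) 0).multiIterate_totalD_const_mul 0 J
  simpa [← Pi.zero_def] using h

/-! ### The Euler operator -/

/-- The summand of `E_α` belonging to the multi-index `J`. -/
def eulerTerm (α : Fin q) (F : JetInf p q → ℝ) (z : JetInf p q) (J : MultiIndex p) : ℝ :=
  (-1) ^ absOrder J * multiIterate totalD J (partialU J α F) z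

lemma eulerTerm_eq_zero_of_lt {N : ℕ} (f : Jet p q N → ℝ) {J : MultiIndex p}
    (hJ : N < absOrder J) (α : Fin q) (z : JetInf p q) :
    eulerTerm α (fun z => f (truncJet N z)) z J = 0 := by
  simp [eulerTerm, partialU_eq_zero_of_lt f hJ, multiIterate_totalD_zero]

lemma IsSmoothJetFun.finite_support_eulerTerm {F : JetInf p q → ℝ} (hF : IsSmoothJetFun F)
    (α : Fin q) (z : JetInf p q) : (Function.support (eulerTerm α F z)).Finite := by
  obtain ⟨N, f, -, rfl⟩ := hF
  exact finite_support_of_absOrder N fun J hJ => eulerTerm_eq_zero_of_lt f hJ α z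

lemma IsSmoothJetFun.euler_add {F G : JetInf p q → ℝ} (hF : IsSmoothJetFun F)
    (hG : IsSmoothJetFun G) (α : Fin q) (z : JetInf p q) :
    euler α (fun z => F z + G z) z = euler α F z + euler α G z := by
  refine Eq.trans (finsum_congr fun J => ?_) (finsum_add_distrib
    (hF.finite_support_eulerTerm α z) (hG.finite_support_eulerTerm α z))
  have : NonlocalLagrangian.partialU J α (fun z => F z + G z) = fun z =>
      NonlocalLagrangian.partialU J α F z + NonlocalLagrangian.partialU J α G z :=
    funext fun z => hF.lineDeriv_add hG z _
  rw [this, (hF.partialU J α).multiIterate_totalD_add (hG.partialU J α)]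
  simp only [mul_add]

lemma euler_zero (α : Fin q) (z : JetInf p q) : euler α (fun _ => (0 : ℝ)) z = 0 := by
  have h0 := isSmoothJetFun_const (p := p) (q := q) 0
  have h := h0.euler_add h0 α z
  simp only [add_zero] at h
  linarith

lemma euler_finset_sum {ι : Type*} (s : Finset ι) {F : ι → JetInf p q → ℝ}
    (hF : ∀ i ∈ s, IsSmoothJetFun (F i)) (α : Fin q) (z : JetInf p q) :
    euler α (fun z => ∑ i ∈ s, F i z) z = ∑ i ∈ s, euler α (F i) z := by
  classical
  induction s using Finset.induction_on with
  | empty => simpa using euler_zero α z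
  | insert a s ha ih =>
    simp only [Finset.sum_insert ha]
    have hs : ∀ i ∈ s, IsSmoothJetFun (F i) := fun i hi => hF i (by simp [hi])
    rw [(hF a (by simp)).euler_add (isSmoothJetFun_finset_sum s hs), ih hs]

lemma finsum_eq_finsum_comp {ι κ M : Type*} [AddCommMonoid M] {g : κ → ι}
    (hg : Function.Injective g) {f : ι → M} (hf : ∀ x, f x ≠ 0 → x ∈ Set.range g) :
    ∑ᶠ x, f x = ∑ᶠ k, f (g k) := by
  rw [← finsum_mem_range hg, ← finsum_mem_univ f]
  exact finsum_mem_inter_support_eq' f _ _ fun x hx => by simpa using hf x hx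

lemma euler_totalD {F : JetInf p q → ℝ} (hF : IsSmoothJetFun F) (i : Fin p) (α : Fin q)
    (z : JetInf p q) : euler α (totalD i F) z = 0 := by
  obtain ⟨N, hN⟩ := hF.exists_partialU_eq_zero
  -- `T` collects the terms where `D_i` passes through `∂/∂u_J`, and `h` the commutator terms.
  -- Shifting the index by `i` turns `h` into `-T`, the sign coming from the increase of the order
  -- by one.
  set T : MultiIndex p → ℝ := fun J =>
    (-1) ^ absOrder J * multiIterate totalD (J + Pi.single i 1) (partialU J α F) z with hT
  set h : MultiIndex p → ℝ := fun J => if 0 < J i then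
    (-1) ^ absOrder J * multiIterate totalD J (partialU (J - Pi.single i 1) α F) z else 0 with hh
  have hterm : ∀ J, eulerTerm α (totalD i F) z J = T J + h J := by
    intro J
    rw [eulerTerm, hF.partialU_totalD]
    by_cases hJ : 0 < J i
    · simp only [hJ, if_true, hT, hh]
      rw [((hF.partialU J α).totalD i).multiIterate_totalD_add (hF.partialU _ α),
        (hF.partialU J α).multiIterate_totalD_add_single, mul_add]
    · simp only [hJ, if_false, hT, hh, add_zero]
      rw [(hF.partialU J α).multiIterate_totalD_add_single]
  have hT0 : ∀ J, N < absOrder J → T J = 0 := fun J hJ => by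
    simp [hT, hN J hJ, multiIterate_totalD_zero]
  have hshift : ∀ K, h (K + Pi.single i 1) = -T K := by
    intro K
    simp only [hh, hT, absOrder_add_single, pow_succ]
    simp
  have hinj : Function.Injective fun K : MultiIndex p => K + Pi.single i 1 :=
    add_left_injective _
  have hrange : ∀ J, h J ≠ 0 → J ∈ Set.range fun K : MultiIndex p => K + Pi.single i 1 := by
    intro J hJ
    have hJi : 0 < J i := by
      by_contra hc
      exact hJ (by simp [hh, hc])
    refine ⟨J - Pi.single i 1, ?_⟩
    funext k
    by_cases hk : k = i
    · subst hk; simp; omega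
    · simp [hk]
  have hTfin := finite_support_of_absOrder N hT0
  have hhfin : (Function.support h).Finite := by
    refine (hTfin.image fun K : MultiIndex p => K + Pi.single i 1).subset fun J hJ => ?_
    obtain ⟨K, rfl⟩ := hrange J hJ
    refine ⟨K, fun h0 => hJ ?_, rfl⟩
    simp only [hshift, h0, neg_zero]
  calc euler α (totalD i F) z = ∑ᶠ J, (T J + h J) := finsum_congr hterm
    _ = ∑ᶠ J, T J + ∑ᶠ J, h J := finsum_add_distrib hTfin hhfin
    _ = 0 := by
      rw [finsum_eq_finsum_comp hinj hrange]
      simp only [hshift, finsum_neg_distrib]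
      simp

/-! ### Locality -/

/-- A set that is open in the base alone suffices: every line through `z` stays over `V` for small
parameters, whatever happens in the fibre. -/
lemma lineDeriv_congr_of_base {V : Set (Base p)} (hV : IsOpen V)
    {F G : JetInf p q → ℝ} (h : ∀ z : JetInf p q, z.1 ∈ V → F z = G z)
    {z : JetInf p q} (hz : z.1 ∈ V) (v : JetInf p q) :
    lineDeriv ℝ F z v = lineDeriv ℝ G z v := by
  refine Filter.EventuallyEq.deriv_eq ?_
  have hc : Continuous fun t : ℝ => z.1 + t • v.1 := by fun_prop
  filter_upwards [(hV.preimage hc).mem_nhds (show (0 : ℝ) ∈ _ by simpa using hz)] with t ht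
  exact h _ ht

lemma totalD_congr_of_base {V : Set (Base p)} (hV : IsOpen V)
    {F G : JetInf p q → ℝ} (h : ∀ z : JetInf p q, z.1 ∈ V → F z = G z)
    (i : Fin p) (z : JetInf p q) (hz : z.1 ∈ V) : totalD i F z = totalD i G z := by
  simp only [totalD, partialX, partialU, lineDeriv_congr_of_base hV h hz]

lemma euler_congr_of_base {V : Set (Base p)} (hV : IsOpen V)
    {F G : JetInf p q → ℝ} (h : ∀ z : JetInf p q, z.1 ∈ V → F z = G z)
    (α : Fin q) (z : JetInf p q) (hz : z.1 ∈ V) : euler α F z = euler α G z := by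
  refine finsum_congr fun J => ?_
  congr 1
  exact multiIterate_rel₂ (R := fun f g : JetInf p q → ℝ => ∀ z : JetInf p q, z.1 ∈ V → f z = g z)
    (fun i f g hfg => totalD_congr_of_base hV hfg i) J
    (fun z hz => lineDeriv_congr_of_base hV h hz _) z hz

/-- The Euler operator annihilates total divergences. -/
lemma euler_eq_zero_of_eq_totalDiv {V : Set (Base p)} (hV : IsOpen V)
    {G : JetInf p q → ℝ} {N : ℕ} {P : Fin p → Jet p q N → ℝ}
    (hP : ∀ i, ContDiffOn ℝ ∞ (P i) {b | b.1 ∈ V})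
    (hG : ∀ z : JetInf p q, z.1 ∈ V → G z = totalDiv (fun i w => P i (truncJet N w)) z)
    (α : Fin q) (z : JetInf p q) (hz : z.1 ∈ V) : euler α G z = 0 := by
  obtain ⟨r, hr, hrV⟩ := Metric.isOpen_iff.1 hV z.1 hz
  -- Multiplying `P i` by a bump supported in `V` makes it smooth on the whole jet space. The bump
  -- is `1` on the ball of radius `r / 4`, so the divergence is unchanged there, and the Euler
  -- operator at `z` sees nothing else.
  let χ : ContDiffBump z.1 := ⟨r / 4, r / 2, by positivity, by linarith⟩
  have hsub : tsupport χ ⊆ V := by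
    rw [χ.tsupport_eq]
    exact (Metric.closedBall_subset_ball (show r / 2 < r by linarith)).trans hrV
  let Q : Fin p → Jet p q N → ℝ := fun i b => χ b.1 * P i b
  have hQ : ∀ i, ContDiff ℝ ∞ (Q i) := by
    intro i
    rw [contDiff_iff_contDiffAt]
    intro b
    by_cases hb : b.1 ∈ V
    · refine ContDiffAt.mul (χ.contDiff.comp contDiff_fst).contDiffAt ((hP i).contDiffAt ?_)
      exact (hV.preimage continuous_fst).mem_nhds hb
    · have hb' : b.1 ∉ tsupport χ := fun hc => hb (hsub hc)
      refine (contDiffAt_const (c := (0 : ℝ))).congr_of_eventuallyEq ?_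
      filter_upwards [((isClosed_tsupport χ).isOpen_compl.preimage continuous_fst).mem_nhds hb']
        with b' hb'
      have : χ b'.1 = 0 := image_eq_zero_of_notMem_tsupport hb'
      simp [Q, this]
  have hQs : ∀ i, IsSmoothJetFun fun w => Q i (truncJet N w) := fun i => ⟨N, Q i, hQ i, rfl⟩
  have hball : ∀ w : JetInf p q, w.1 ∈ Metric.ball z.1 (r / 4) →
      G w = ∑ i, totalD i (fun w => Q i (truncJet N w)) w := by
    intro w hw
    rw [hG w (hrV (Metric.ball_subset_ball (by linarith) hw)), totalDiv]
    refine Finset.sum_congr rfl fun i _ => ?_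
    refine totalD_congr_of_base Metric.isOpen_ball (fun w' hw' => ?_) i w hw
    have : χ w'.1 = 1 := χ.one_of_mem_closedBall (Metric.ball_subset_closedBall hw')
    simp [Q, truncJet, this]
  rw [euler_congr_of_base Metric.isOpen_ball hball α z (Metric.mem_ball_self (by linarith)),
    euler_finset_sum _ fun i _ => (hQs i).totalD i]
  exact Finset.sum_eq_zero fun i _ => euler_totalD (hQs i) i α z

/-! ### Integrals depending smoothly on a parameter -/

section Dominated

set_option linter.unusedSectionVars false

variable {X E' E E₁ F G : Type} [MeasurableSpace X] [NormedAddCommGroup E'] [NormedSpace ℝ E']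
  [NormedAddCommGroup E] [NormedSpace ℝ E] [NormedAddCommGroup E₁] [NormedSpace ℝ E₁]
  [NormedAddCommGroup F] [NormedSpace ℝ F] [NormedAddCommGroup G] [NormedSpace ℝ G]

/-- All derivatives of `b ↦ h (a x) b` are bounded by integrable functions of `x`, locally
uniformly in `b`. -/
def IsDominated (μ : Measure X) (a : X → E') (h : E' → E → F) : Prop :=
  ∀ (k : ℕ) (K : Set E), IsCompact K → ∃ g : X → ℝ, Integrable g μ ∧
    ∀ᵐ x ∂μ, ∀ b ∈ K, ‖iteratedFDeriv ℝ k (h (a x)) b‖ ≤ g x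

variable {μ : Measure X} {a : X → E'}

lemma contDiff_of_uncurry {h : E' → E → F} (hh : ContDiff ℝ ∞ (Function.uncurry h)) (e : E') :
    ContDiff ℝ ∞ (h e) :=
  hh.comp (contDiff_const.prodMk contDiff_id)

lemma contDiff_uncurry_fderiv {h : E' → E → F} (hh : ContDiff ℝ ∞ (Function.uncurry h)) :
    ContDiff ℝ ∞ (Function.uncurry fun e b => fderiv ℝ (h e) b) := by
  refine ContDiff.fderiv (f := fun c : E' × E => h c.1) (g := Prod.snd) (m := ∞) ?_ contDiff_snd
    (by simp)
  exact hh.comp ((contDiff_fst.comp contDiff_fst).prodMk contDiff_snd)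

/-- The `k`-th derivative of the new family is the `(k + 1)`-st of the old one; this is why all
orders are bounded at once. -/
lemma IsDominated.fderiv {h : E' → E → F} (hd : IsDominated μ a h) :
    IsDominated μ a fun e b => fderiv ℝ (h e) b := by
  intro k K hK
  obtain ⟨g, hg, hb⟩ := hd (k + 1) K hK
  refine ⟨g, hg, hb.mono fun x hx b hbK => ?_⟩
  exact norm_iteratedFDeriv_fderiv.trans_le (hx b hbK)

lemma IsDominated.comp_clm {h : E' → E → F} (hd : IsDominated μ a h)
    (hh : ContDiff ℝ ∞ (Function.uncurry h)) (R : E₁ →L[ℝ] E) :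
    IsDominated μ a fun e b => h e (R b) := by
  intro k K hK
  obtain ⟨g, hg, hb⟩ := hd k (R '' K) (hK.image R.continuous)
  refine ⟨fun x => g x * ∏ _i : Fin k, ‖R‖, hg.mul_const _, hb.mono fun x hx b hbK => ?_⟩
  have := R.iteratedFDeriv_comp_right (contDiff_of_uncurry hh (a x)) b (i := k)
    (mod_cast le_top)
  change ‖iteratedFDeriv ℝ k (h (a x) ∘ R) b‖ ≤ _
  rw [this]
  refine (ContinuousMultilinearMap.norm_compContinuousLinearMap_le _ _).trans ?_
  exact mul_le_mul_of_nonneg_right (hx _ ⟨b, hbK, rfl⟩)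
    (Finset.prod_nonneg fun _ _ => norm_nonneg _)

/-- By the Leibniz estimate the derivatives of the product are bounded by finite sums of integrable
bounds for `h` times constants bounding the derivatives of `W` on `K`. -/
lemma IsDominated.clm_apply {h : E' → E → (F →L[ℝ] G)} (hd : IsDominated μ a h)
    (hh : ContDiff ℝ ∞ (Function.uncurry h)) {W : E → F} (hW : ContDiff ℝ ∞ W) :
    IsDominated μ a fun e b => h e b (W b) := by
  intro k K hK
  choose g hg hb using fun i => hd i K hK
  have hC : ∀ i : ℕ, ∃ C, ∀ b ∈ K, ‖iteratedFDeriv ℝ i W b‖ ≤ C := fun i =>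
    hK.exists_bound_of_continuousOn
      (hW.continuous_iteratedFDeriv (m := i) (mod_cast le_top)).continuousOn
  choose C hC using hC
  refine ⟨fun x => ∑ i ∈ Finset.range (k + 1), (k.choose i : ℝ) * g i x * C (k - i), ?_, ?_⟩
  · exact integrable_finsetSum _ fun i _ => ((hg i).const_mul _).mul_const _
  · filter_upwards [ae_all_iff.2 hb] with x hx b hbK
    refine (norm_iteratedFDeriv_clm_apply (contDiff_of_uncurry hh (a x)) hW b
      (mod_cast le_top)).trans (Finset.sum_le_sum fun i _ => ?_)
    have h1 := hx i b hbK
    have h2 := hC (k - i) b hbK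
    have h3 := (norm_nonneg _).trans h1
    gcongr

variable [ProperSpace E]

lemma aestronglyMeasurable_param {h : E' → E → F} (hh : ContDiff ℝ ∞ (Function.uncurry h))
    (ha : AEStronglyMeasurable a μ) (b : E) : AEStronglyMeasurable (fun x => h (a x) b) μ :=
  (hh.continuous.comp (continuous_id.prodMk continuous_const)).comp_aestronglyMeasurable ha

lemma IsDominated.integrable {h : E' → E → F} (hd : IsDominated μ a h)
    (hh : ContDiff ℝ ∞ (Function.uncurry h)) (ha : AEStronglyMeasurable a μ) (b : E) :
    Integrable (fun x => h (a x) b) μ := by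
  obtain ⟨g, hg, hb⟩ := hd 0 {b} isCompact_singleton
  refine hg.mono' (aestronglyMeasurable_param hh ha b) (hb.mono fun x hx => ?_)
  simpa using hx b rfl

lemma IsDominated.hasFDerivAt_integral {h : E' → E → F} (hd : IsDominated μ a h)
    (hh : ContDiff ℝ ∞ (Function.uncurry h)) (ha : AEStronglyMeasurable a μ) (b : E) :
    HasFDerivAt (fun b => ∫ x, h (a x) b ∂μ) (∫ x, _root_.fderiv ℝ (h (a x)) b ∂μ) b := by
  obtain ⟨g, hg, hb⟩ := hd 1 (Metric.closedBall b 1) (isCompact_closedBall b 1)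
  refine hasFDerivAt_integral_of_dominated_of_fderiv_le
    (F' := fun b x => _root_.fderiv ℝ (h (a x)) b) (bound := g)
    (Metric.closedBall_mem_nhds b one_pos)
    (Filter.Eventually.of_forall fun b => aestronglyMeasurable_param hh ha b)
    (hd.integrable hh ha b)
    (aestronglyMeasurable_param (contDiff_uncurry_fderiv hh) ha b) ?_ hg ?_
  · exact hb.mono fun x hx b' hb' => by simpa [norm_iteratedFDeriv_one] using hx b' hb'
  · exact Filter.Eventually.of_forall fun x b' _ =>
      ((contDiff_of_uncurry hh (a x)).differentiable (by simp) b').hasFDerivAt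

/-- The derivative of the integral is the integral of another dominated family, so regularity
bootstraps. The target space is quantified inside the induction because it becomes a space of linear
maps at each step. -/
lemma IsDominated.contDiff_integral_nat (n : ℕ) : ∀ {F : Type} [NormedAddCommGroup F]
    [NormedSpace ℝ F] {h : E' → E → F}, IsDominated μ a h → ContDiff ℝ ∞ (Function.uncurry h) →
    AEStronglyMeasurable a μ → ContDiff ℝ n (fun b => ∫ x, h (a x) b ∂μ) := by
  induction n with
  | zero =>
    intro F _ _ h hd hh ha
    exact contDiff_zero.2 (continuous_iff_continuousAt.2 fun b =>
      (hd.hasFDerivAt_integral hh ha b).continuousAt)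
  | succ n ih =>
    intro F _ _ h hd hh ha
    have : _root_.fderiv ℝ (fun b => ∫ x, h (a x) b ∂μ) =
        fun b => ∫ x, _root_.fderiv ℝ (h (a x)) b ∂μ :=
      funext fun b => (hd.hasFDerivAt_integral hh ha b).fderiv
    rw [Nat.cast_succ, contDiff_succ_iff_fderiv, this]
    exact ⟨fun b => (hd.hasFDerivAt_integral hh ha b).differentiableAt, by simp,
      ih hd.fderiv (contDiff_uncurry_fderiv hh) ha⟩

lemma IsDominated.contDiff_integral {h : E' → E → F} (hd : IsDominated μ a h)
    (hh : ContDiff ℝ ∞ (Function.uncurry h)) (ha : AEStronglyMeasurable a μ) :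
    ContDiff ℝ ∞ (fun b => ∫ x, h (a x) b ∂μ) :=
  contDiff_infty.2 fun n => hd.contDiff_integral_nat n hh ha

lemma IsDominated.fderiv_integral_apply {h : E' → E → F} (hd : IsDominated μ a h)
    (hh : ContDiff ℝ ∞ (Function.uncurry h)) (ha : AEStronglyMeasurable a μ) (b v : E)
    [CompleteSpace F] :
    _root_.fderiv ℝ (fun b => ∫ x, h (a x) b ∂μ) b v = ∫ x, _root_.fderiv ℝ (h (a x)) b v ∂μ := by
  rw [(hd.hasFDerivAt_integral hh ha b).fderiv, ContinuousLinearMap.integral_apply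
    (hd.fderiv.integrable (contDiff_uncurry_fderiv hh) ha b)]

end Dominated

/-! ### Families of functions on jets -/

section Family

variable {X E' : Type} [MeasurableSpace X] [NormedAddCommGroup E'] [NormedSpace ℝ E']
  {μ : Measure X} {a : X → E'} {F : X → JetInf p q → ℝ}

/-- Families of smooth functions of finitely many jet coordinates that can be differentiated under
the integral sign. -/
def IsDominatedFamily (μ : Measure X) (a : X → E') (F : X → JetInf p q → ℝ) : Prop :=
  ∃ (N : ℕ) (h : E' → Jet p q N → ℝ), ContDiff ℝ ∞ (Function.uncurry h) ∧ IsDominated μ a h ∧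
    F = fun x z => h (a x) (truncJet N z)

/-- The projection `J^N → J^n` as a continuous linear map. -/
def restrictJetL {n N : ℕ} (h : n ≤ N) : Jet p q N →L[ℝ] Jet p q n where
  toFun := restrictJet h
  map_add' _ _ := rfl
  map_smul' _ _ := rfl
  cont := (contDiff_restrictJet h (k := 0)).continuous

lemma IsDominatedFamily.isSmoothJetFun (hF : IsDominatedFamily μ a F) (x : X) :
    IsSmoothJetFun (F x) := by
  obtain ⟨N, h, hh, -, rfl⟩ := hF
  exact ⟨N, h (a x), contDiff_of_uncurry hh _, rfl⟩

lemma IsDominatedFamily.integrable (hF : IsDominatedFamily μ a F)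
    (ha : AEStronglyMeasurable a μ) (z : JetInf p q) : Integrable (fun x => F x z) μ := by
  obtain ⟨N, h, hh, hd, rfl⟩ := hF
  exact hd.integrable hh ha _

lemma IsDominatedFamily.isSmoothJetFun_integral (hF : IsDominatedFamily μ a F)
    (ha : AEStronglyMeasurable a μ) : IsSmoothJetFun fun z => ∫ x, F x z ∂μ := by
  obtain ⟨N, h, hh, hd, rfl⟩ := hF
  exact ⟨N, _, hd.contDiff_integral hh ha, rfl⟩

lemma IsDominatedFamily.lineDeriv_integral (hF : IsDominatedFamily μ a F)
    (ha : AEStronglyMeasurable a μ) (z v : JetInf p q) :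
    lineDeriv ℝ (fun z => ∫ x, F x z ∂μ) z v = ∫ x, lineDeriv ℝ (F x) z v ∂μ := by
  obtain ⟨N, h, hh, hd, rfl⟩ := hF
  rw [lineDeriv_comp_truncJet (f := fun b => ∫ x, h (a x) b ∂μ)
    ((hd.contDiff_integral hh ha).differentiable (by simp) _), hd.fderiv_integral_apply hh ha]
  refine integral_congr_ae (Filter.Eventually.of_forall fun x => ?_)
  exact (lineDeriv_comp_truncJet ((contDiff_of_uncurry hh (a x)).differentiable (by simp) _) v).symm

lemma IsDominatedFamily.lineDeriv (hF : IsDominatedFamily μ a F) {V : JetInf p q → JetInf p q}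
    (hV : IsSmoothJetField V) :
    IsDominatedFamily μ a fun x z => lineDeriv ℝ (F x) z (V z) := by
  obtain ⟨N, h, hh, hd, rfl⟩ := hF
  obtain ⟨M, hNM, W, hW, hVW⟩ := hV N
  have hf := contDiff_uncurry_fderiv hh
  have hR : ContDiff ℝ ∞ (Function.uncurry fun e (b : Jet p q M) =>
      fderiv ℝ (h e) (restrictJetL hNM b)) :=
    hf.comp (contDiff_fst.prodMk ((restrictJetL hNM).contDiff.comp contDiff_snd))
  refine ⟨M, fun e b => fderiv ℝ (h e) (restrictJetL hNM b) (W b), ?_,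
    (hd.fderiv.comp_clm hf (restrictJetL hNM)).clm_apply hR hW, ?_⟩
  · exact hR.clm_apply (hW.comp contDiff_snd)
  · funext x z
    rw [lineDeriv_comp_truncJet ((contDiff_of_uncurry hh (a x)).differentiable (by simp) _), hVW]
    rfl

lemma IsDominatedFamily.partialU (hF : IsDominatedFamily μ a F) (J : MultiIndex p) (α : Fin q) :
    IsDominatedFamily μ a fun x => partialU J α (F x) :=
  hF.lineDeriv (isSmoothJetField_const _)

lemma IsDominatedFamily.totalD (hF : IsDominatedFamily μ a F) (i : Fin p) :
    IsDominatedFamily μ a fun x => totalD i (F x) := by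
  simp only [(hF.isSmoothJetFun _).totalD_eq]
  exact hF.lineDeriv (isSmoothJetField_totalField i)

lemma IsDominatedFamily.totalD_integral (hF : IsDominatedFamily μ a F)
    (ha : AEStronglyMeasurable a μ) (i : Fin p) :
    NonlocalLagrangian.totalD i (fun z => ∫ x, F x z ∂μ) =
      fun z => ∫ x, NonlocalLagrangian.totalD i (F x) z ∂μ := by
  simp only [(hF.isSmoothJetFun _).totalD_eq, (hF.isSmoothJetFun_integral ha).totalD_eq]
  exact funext fun z => hF.lineDeriv_integral ha z _

lemma IsDominatedFamily.multiIterate_totalD (hF : IsDominatedFamily μ a F)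
    (ha : AEStronglyMeasurable a μ) (J : MultiIndex p) :
    IsDominatedFamily μ a (fun x => multiIterate NonlocalLagrangian.totalD J (F x)) ∧
      multiIterate NonlocalLagrangian.totalD J (fun z => ∫ x, F x z ∂μ) =
        fun z => ∫ x, multiIterate NonlocalLagrangian.totalD J (F x) z ∂μ := by
  have h1 : multiIterate (fun i (F : X → JetInf p q → ℝ) x => NonlocalLagrangian.totalD i (F x))
      J F = fun x => multiIterate NonlocalLagrangian.totalD J (F x) :=
    funext fun x => multiIterate_rel₂ (R := fun (F : X → JetInf p q → ℝ) G => F x = G)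
      (by rintro i F _ rfl; rfl) J rfl
  have h2 := multiIterate_rel₂ (R := fun (F : X → JetInf p q → ℝ) G =>
      IsDominatedFamily μ a F ∧ G = fun z => ∫ x, F x z ∂μ)
    (D₁ := fun i F x => NonlocalLagrangian.totalD i (F x)) (D₂ := NonlocalLagrangian.totalD)
    (by
      rintro i F _ ⟨hF, rfl⟩
      exact ⟨hF.totalD i, hF.totalD_integral ha i⟩) J ⟨hF, rfl⟩
  rwa [h1] at h2

lemma IsDominatedFamily.euler_integral (hF : IsDominatedFamily μ a F)
    (ha : AEStronglyMeasurable a μ) (α : Fin q) (z : JetInf p q) :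
    euler α (fun z => ∫ x, F x z ∂μ) z = ∫ x, euler α (F x) z ∂μ := by
  have hterm : ∀ J, eulerTerm α (fun z => ∫ x, F x z ∂μ) z J = ∫ x, eulerTerm α (F x) z J ∂μ ∧
      Integrable (fun x => eulerTerm α (F x) z J) μ := by
    intro J
    have h1 : NonlocalLagrangian.partialU J α (fun z => ∫ x, F x z ∂μ) =
        fun z => ∫ x, NonlocalLagrangian.partialU J α (F x) z ∂μ :=
      funext fun z => hF.lineDeriv_integral ha z _
    obtain ⟨h2, h3⟩ := (hF.partialU J α).multiIterate_totalD ha J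
    simp only [eulerTerm]
    refine ⟨?_, (h2.integrable ha z).const_mul _⟩
    rw [h1, h3, integral_const_mul]
  -- One order `N` serves all `x`, so the `finsum` is the same finite sum for every member of the
  -- family and commutes with the integral.
  obtain ⟨N, h, -, -, rfl⟩ := hF
  have h0 : ∀ f : Jet p q N → ℝ, euler α (fun z => f (truncJet N z)) z =
      ∑ J : MultiIndexLE p N, eulerTerm α (fun z => f (truncJet N z)) z J.1 := fun f =>
    finsum_multiIndex_eq_sum N fun J hJ => eulerTerm_eq_zero_of_lt f hJ α z
  rw [h0 fun b => ∫ x, h (a x) b ∂μ]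
  simp only [h0]
  rw [integral_finsetSum _ fun J _ => (hterm J.1).2]
  exact Finset.sum_congr rfl fun J _ => (hterm J.1).1

end Family

/-! ### Integration over the unit interval -/

/-- Continuity of `h` in both variables gives the bound for `k = 0`; higher orders follow since
`fderiv` of the slices is again jointly smooth. -/
lemma exists_bound_iteratedFDeriv {E : Type} [NormedAddCommGroup E] [NormedSpace ℝ E] (k : ℕ) :
    ∀ {F : Type} [NormedAddCommGroup F] [NormedSpace ℝ F] {h : ℝ → E → F},
    ContDiff ℝ ∞ (Function.uncurry h) → ∀ {S : Set ℝ} {K : Set E}, IsCompact S → IsCompact K →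
    ∃ C, ∀ s ∈ S, ∀ b ∈ K, ‖iteratedFDeriv ℝ k (h s) b‖ ≤ C := by
  induction k with
  | zero =>
    intro F _ _ h hh S K hS hK
    obtain ⟨C, hC⟩ := (hS.prod hK).exists_bound_of_continuousOn hh.continuous.continuousOn
    exact ⟨C, fun s hs b hb => by simpa using hC (s, b) ⟨hs, hb⟩⟩
  | succ k ih =>
    intro F _ _ h hh S K hS hK
    obtain ⟨C, hC⟩ := ih (contDiff_uncurry_fderiv hh) hS hK
    exact ⟨C, fun s hs b hb => norm_iteratedFDeriv_fderiv.symm.trans_le (hC s hs b hb)⟩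

lemma isDominated_unitInterval {E F : Type} [NormedAddCommGroup E] [NormedSpace ℝ E]
    [NormedAddCommGroup F] [NormedSpace ℝ F] {h : ℝ → E → F}
    (hh : ContDiff ℝ ∞ (Function.uncurry h)) :
    IsDominated (volume.restrict (Set.Ioc (0 : ℝ) 1)) id h := by
  intro k K hK
  obtain ⟨C, hC⟩ := exists_bound_iteratedFDeriv k hh (isCompact_Icc (a := (0 : ℝ)) (b := 1)) hK
  refine ⟨fun _ => C, integrable_const C, ?_⟩
  filter_upwards [ae_restrict_mem measurableSet_Ioc] with x hx b hb
  exact hC x (Set.Ioc_subset_Icc_self hx) b hb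

lemma isDominatedFamily_unitInterval {N : ℕ} {h : ℝ → Jet p q N → ℝ}
    (hh : ContDiff ℝ ∞ (Function.uncurry h)) :
    IsDominatedFamily (volume.restrict (Set.Ioc (0 : ℝ) 1)) id
      (fun s z => h s (truncJet N z)) :=
  ⟨N, h, hh, isDominated_unitInterval hh, rfl⟩

/-! ### Scaling of the fibres -/

/-- The map `(x, u) ↦ (x, ε u)`. -/
def scaleJet (ε : ℝ) (z : JetInf p q) : JetInf p q := (z.1, ε • z.2)

/-- Functions `A` for which `A (x, ε u) / ε` is smooth up to `ε = 0`. -/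
def IsFibreDivisible (A : JetInf p q → ℝ) : Prop :=
  ∃ (N : ℕ) (a : ℝ → Jet p q N → ℝ), ContDiff ℝ ∞ (Function.uncurry a) ∧
    ∀ ε z, A (scaleJet ε z) = ε * a ε (truncJet N z)

lemma IsFibreDivisible.add {A B : JetInf p q → ℝ} (hA : IsFibreDivisible A)
    (hB : IsFibreDivisible B) : IsFibreDivisible fun z => A z + B z := by
  obtain ⟨N, a, ha, hAa⟩ := hA
  obtain ⟨M, b, hb, hBb⟩ := hB
  refine ⟨max N M, fun ε c => a ε (restrictJet (le_max_left N M) c) +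
    b ε (restrictJet (le_max_right N M) c), ?_, fun ε z => ?_⟩
  · exact (ha.comp (contDiff_fst.prodMk
      ((contDiff_restrictJet (le_max_left N M)).comp contDiff_snd))).add
      (hb.comp (contDiff_fst.prodMk
        ((contDiff_restrictJet (le_max_right N M)).comp contDiff_snd)))
  · simp only [hAa, hBb, mul_add]
    rfl

lemma IsFibreDivisible.const_mul {A : JetInf p q → ℝ} (hA : IsFibreDivisible A) (c : ℝ) :
    IsFibreDivisible fun z => c * A z := by
  obtain ⟨N, a, ha, hAa⟩ := hA
  refine ⟨N, fun ε b => c * a ε b, contDiff_const.mul ha, fun ε z => ?_⟩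
  simp only [hAa]
  ring

lemma isFibreDivisible_zero : IsFibreDivisible fun _ : JetInf p q => (0 : ℝ) :=
  ⟨0, fun _ _ => 0, contDiff_const, fun _ _ => by simp⟩

lemma isFibreDivisible_finset_sum {ι : Type*} (s : Finset ι) {A : ι → JetInf p q → ℝ}
    (hA : ∀ i ∈ s, IsFibreDivisible (A i)) : IsFibreDivisible fun z => ∑ i ∈ s, A i z := by
  classical
  induction s using Finset.induction_on with
  | empty => simpa using isFibreDivisible_zero
  | insert a s ha ih =>
    simp only [Finset.sum_insert ha]
    exact (hA a (by simp)).add (ih fun i hi => hA i (by simp [hi]))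

lemma IsSmoothJetFun.isFibreDivisible_coord_mul {F : JetInf p q → ℝ} (hF : IsSmoothJetFun F)
    (J : MultiIndex p) (α : Fin q) : IsFibreDivisible fun z => z.2 J α * F z := by
  obtain ⟨N, f, hN, hf, rfl⟩ := hF.exists_rep_ge (absOrder J)
  refine ⟨N, fun ε b => b.2 ⟨J, hN⟩ α * f (b.1, ε • b.2), ?_, fun ε z => ?_⟩
  · refine ContDiff.mul (by fun_prop) (hf.comp ?_)
    fun_prop
  · simp only [scaleJet, Pi.smul_apply, smul_eq_mul, mul_assoc]
    rfl

/-- Fibre scaling is linear, fixes the base component and maps the vector field of `D_i` to itself,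
since the fibre components of that field are linear in the jet. -/
lemma IsSmoothJetFun.totalD_scaleJet {A : JetInf p q → ℝ} (hA : IsSmoothJetFun A) {N : ℕ} {ε : ℝ}
    {a : Jet p q N → ℝ} (ha : ContDiff ℝ ∞ a)
    (hAa : ∀ z, A (scaleJet ε z) = ε * a (truncJet N z)) (i : Fin p) (z : JetInf p q) :
    NonlocalLagrangian.totalD i A (scaleJet ε z) =
      ε * NonlocalLagrangian.totalD i (fun z => a (truncJet N z)) z := by
  have hs : IsSmoothJetFun fun z : JetInf p q => a (truncJet N z) := ⟨N, a, ha, rfl⟩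
  have h1 := congrFun (hs.totalD_const_mul ε i) z
  rw [← h1, (hs.const_mul ε).totalD_eq, hA.totalD_eq]
  simp only [← hAa]
  have : ∀ t : ℝ, scaleJet ε z + t • totalField i (scaleJet ε z) =
      scaleJet ε (z + t • totalField i z) := by
    intro t
    refine Prod.ext rfl (funext fun J => funext fun α => ?_)
    simp [scaleJet, totalField]
    ring
  simp only [_root_.lineDeriv, this]

/-! ### Integration by parts -/

lemma totalD_finset_sum {ι : Type*} (s : Finset ι) {F : ι → JetInf p q → ℝ}
    (hF : ∀ i ∈ s, IsSmoothJetFun (F i)) (i : Fin p) (z : JetInf p q) :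
    totalD i (fun z => ∑ j ∈ s, F j z) z = ∑ j ∈ s, totalD i (F j) z := by
  classical
  induction s using Finset.induction_on with
  | empty =>
    have := congrFun ((isSmoothJetFun_const (p := p) (q := q) 0).totalD_const_mul 0 i) z
    simpa using this
  | insert a s ha ih =>
    simp only [Finset.sum_insert ha]
    have hs : ∀ i ∈ s, IsSmoothJetFun (F i) := fun i hi => hF i (by simp [hi])
    rw [← ih hs]
    exact congrFun ((hF a (by simp)).totalD_add (isSmoothJetFun_finset_sum s hs) i) z

lemma exists_eq_add_single {J : MultiIndex p} {k : ℕ} (hJ : absOrder J = k + 1) :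
    ∃ (K : MultiIndex p) (i : Fin p), absOrder K = k ∧ J = K + Pi.single i 1 := by
  obtain ⟨i, hi⟩ : ∃ i, J i ≠ 0 := by
    by_contra! h
    simp [absOrder, h] at hJ
  have hJi : J = (J - Pi.single i 1) + Pi.single i 1 := by
    funext l
    by_cases hl : l = i
    · subst hl; simp; omega
    · simp [hl]
  refine ⟨J - Pi.single i 1, i, ?_, hJi⟩
  have := absOrder_add_single (J - Pi.single i 1) i
  rw [← hJi] at this
  omega

/-- Induction on `|J|` through `u_{K,i} Q = u_K (-D_i Q) + D_i (u_K Q)`. Every boundary term has a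
factor `u_K`, which is what yields fibre divisibility. -/
lemma exists_integration_by_parts (α : Fin q) (k : ℕ) : ∀ {J : MultiIndex p}, absOrder J = k →
    ∀ {Q : JetInf p q → ℝ}, IsSmoothJetFun Q →
    ∃ A : Fin p → JetInf p q → ℝ, (∀ i, IsSmoothJetFun (A i)) ∧ (∀ i, IsFibreDivisible (A i)) ∧
      ∀ z, z.2 J α * Q z = z.2 0 α * ((-1) ^ absOrder J * multiIterate totalD J Q z) +
        ∑ i, totalD i (A i) z := by
  induction k with
  | zero =>
    intro J hJ Q hQ
    have : J = 0 := by
      funext i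
      simpa using (Finset.sum_eq_zero_iff.1 hJ) i (Finset.mem_univ i)
    subst this
    refine ⟨fun _ _ => 0, fun _ => isSmoothJetFun_const 0, fun _ => isFibreDivisible_zero,
      fun z => ?_⟩
    have h0 : ∀ i, totalD i (fun _ : JetInf p q => (0 : ℝ)) z = 0 := fun i => by
      simpa using totalD_finset_sum (∅ : Finset ℕ) (F := fun _ _ => 0) (by simp) i z
    simp [hJ, h0]
  | succ k ih =>
    intro J hJ Q hQ
    obtain ⟨K, i, hK, rfl⟩ := exists_eq_add_single hJ
    obtain ⟨A, hAs, hAd, hA⟩ := ih hK ((hQ.totalD i).const_mul (-1))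
    have hKQ : IsSmoothJetFun fun z : JetInf p q => z.2 K α * Q z :=
      (isSmoothJetFun_coord K α).mul hQ
    let c : Fin p → ℝ := fun j => if j = i then 1 else 0
    refine ⟨fun j z => A j z + c j * (z.2 K α * Q z), fun j => (hAs j).add (hKQ.const_mul _),
      fun j => (hAd j).add ((hQ.isFibreDivisible_coord_mul K α).const_mul _), fun z => ?_⟩
    have h1 : ∀ j, totalD j (fun z => A j z + c j * (z.2 K α * Q z)) z =
        totalD j (A j) z + c j * totalD j (fun z => z.2 K α * Q z) z := fun j => by
      rw [(hAs j).totalD_add (hKQ.const_mul _), hKQ.totalD_const_mul]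
    have h2 : totalD i (fun z => z.2 K α * Q z) z =
        z.2 (K + Pi.single i 1) α * Q z + z.2 K α * totalD i Q z := by
      rw [(isSmoothJetFun_coord K α).totalD_mul hQ, totalD_coord]
    have h3 := hA z
    rw [(hQ.totalD i).multiIterate_totalD_const_mul] at h3
    simp only [h1, Finset.sum_add_distrib]
    simp only [c, ite_mul, one_mul, zero_mul, Finset.sum_ite_eq',
      Finset.mem_univ, if_true, h2]
    rw [hQ.multiIterate_totalD_add_single, absOrder_add_single, pow_succ]
    linear_combination h3

lemma IsSmoothJetFun.exists_first_variation {G : JetInf p q → ℝ} (hG : IsSmoothJetFun G) :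
    ∃ A : Fin p → JetInf p q → ℝ, (∀ i, IsSmoothJetFun (A i)) ∧ (∀ i, IsFibreDivisible (A i)) ∧
      ∀ z, _root_.lineDeriv ℝ G z (0, z.2) = ∑ α, z.2 0 α * euler α G z +
        ∑ i, NonlocalLagrangian.totalD i (A i) z := by
  choose A hAs hAd hA using fun (J : MultiIndex p) (α : Fin q) =>
    exists_integration_by_parts α _ (J := J) rfl (hG.partialU J α)
  obtain ⟨N, hN⟩ := hG.exists_partialU_eq_zero
  have hs1 : ∀ i α, IsSmoothJetFun fun z => ∑ J : MultiIndexLE p N, A J.1 α i z := fun i α =>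
    isSmoothJetFun_finset_sum _ fun J _ => hAs J.1 α i
  refine ⟨fun i z => ∑ α, ∑ J : MultiIndexLE p N, A J.1 α i z,
    fun i => isSmoothJetFun_finset_sum _ fun α _ => hs1 i α,
    fun i => isFibreDivisible_finset_sum _ fun α _ => isFibreDivisible_finset_sum _ fun J _ =>
      hAd J.1 α i, fun z => ?_⟩
  have h1 : ∀ i, NonlocalLagrangian.totalD i (fun z => ∑ α, ∑ J : MultiIndexLE p N, A J.1 α i z) z =
      ∑ α, ∑ J : MultiIndexLE p N, NonlocalLagrangian.totalD i (A J.1 α i) z := by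
    intro i
    rw [totalD_finset_sum _ fun α _ => hs1 i α]
    exact Finset.sum_congr rfl fun α _ => totalD_finset_sum _ (fun J _ => hAs J.1 α i) i z
  have h2 : ∀ α, euler α G z = ∑ J : MultiIndexLE p N, (-1) ^ absOrder J.1 *
      multiIterate NonlocalLagrangian.totalD J.1 (NonlocalLagrangian.partialU J.1 α G) z :=
    fun α => finsum_multiIndex_eq_sum N fun J hJ => by
      simp [hN J hJ, multiIterate_totalD_zero]
  rw [← hG.sum_mul_partialU]
  simp only [h1, h2]
  rw [Finset.sum_comm, ← Finset.sum_add_distrib]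
  refine Finset.sum_congr rfl fun α _ => ?_
  rw [finsum_multiIndex_eq_sum N fun J hJ => by simp [hN J hJ], Finset.sum_comm, Finset.mul_sum,
    ← Finset.sum_add_distrib]
  exact Finset.sum_congr rfl fun J _ => hA J.1 α z

/-! ### Exactness -/

lemma integral_unitInterval_eq_sub {f f' g : ℝ → ℝ} (hf : ∀ s, HasDerivAt f (f' s) s)
    (hf' : Continuous f') (hg : ∀ s ∈ Set.Ioc (0 : ℝ) 1, f' s = g s) :
    f 1 - f 0 = ∫ s in Set.Ioc (0 : ℝ) 1, g s := by
  rw [← intervalIntegral.integral_eq_sub_of_hasDerivAt (fun s _ => hf s)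
    (hf'.intervalIntegrable 0 1), intervalIntegral.integral_of_le zero_le_one]
  exact setIntegral_congr_fun measurableSet_Ioc hg

/-- A function of the base point alone is a total divergence. -/
lemma IsSmoothJetFun.exists_totalD_eq_zero_section {G : JetInf p q → ℝ} (hG : IsSmoothJetFun G)
    (i : Fin p) : ∃ C : JetInf p q → ℝ, IsSmoothJetFun C ∧
      ∀ z, NonlocalLagrangian.totalD i C z = G (scaleJet 0 z) := by
  obtain ⟨N, g, hg, rfl⟩ := hG
  let e : Base p := Pi.single i 1
  -- The base point is moved so that its `i`-th coordinate becomes `s x^i`. Integrated over `0 < s ≤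
  -- 1`, this is the primitive of `g (·, 0)` in `x^i` starting from `x^i = 0`, rescaled to a fixed
  -- interval.
  let h : ℝ → Jet p q N → ℝ := fun s b => b.1 i * g (b.1 + ((s - 1) * b.1 i) • e, 0)
  have hh : ContDiff ℝ ∞ (Function.uncurry h) := by
    refine ContDiff.mul (by fun_prop) (hg.comp ?_)
    fun_prop
  have hfam := isDominatedFamily_unitInterval hh
  refine ⟨_, hfam.isSmoothJetFun_integral aestronglyMeasurable_id, fun z => ?_⟩
  rw [hfam.totalD_integral aestronglyMeasurable_id]
  let θ : ℝ → ℝ := fun r => g (z.1 + (r - z.1 i) • e, 0)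
  have hθ : ContDiff ℝ ∞ θ := hg.comp (by fun_prop)
  have hθd : ∀ r, HasDerivAt θ (deriv θ r) r := fun r =>
    (hθ.differentiable (by simp) r).hasDerivAt
  have hend : g (truncJet N (scaleJet 0 z)) = 1 * θ (1 * z.1 i) - 0 * θ (0 * z.1 i) := by
    simp [θ, scaleJet, truncJet]
    rfl
  refine Eq.trans ?_ hend.symm
  -- The `x^i`-derivative of `x^i θ(s x^i)` equals the `s`-derivative of `s θ(s x^i)`, so the
  -- integral telescopes to `θ(x^i)`.
  refine (integral_unitInterval_eq_sub (f := fun s => s * θ (s * z.1 i))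
    (f' := fun s => 1 * θ (s * z.1 i) + s * (deriv θ (s * z.1 i) * z.1 i)) (fun s => ?_) ?_
    fun s _ => ?_).symm
  · refine (hasDerivAt_id s).mul ?_
    have := (hθd (s * z.1 i)).comp s ((hasDerivAt_id s).mul_const (z.1 i))
    simpa [Function.comp_def] using this
  · have := hθ.continuous
    have := hθ.continuous_deriv (by simp)
    fun_prop
  · rw [(hfam.isSmoothJetFun s).totalD_eq]
    have hline : ∀ t : ℝ, h s (truncJet N (z + t • totalField i z)) =
        (z.1 i + t) * θ (s * (z.1 i + t)) := by
      intro t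
      simp only [h, θ, truncJet, totalField, e, Prod.fst_add, Prod.smul_fst, Pi.add_apply,
        Pi.smul_apply, Pi.single_eq_same, smul_eq_mul, mul_one]
      rw [add_assoc, ← add_smul]
      congr 5
      ring
    have hd : HasDerivAt (fun t : ℝ => (z.1 i + t) * θ (s * (z.1 i + t)))
        (1 * θ (s * (z.1 i + 0)) + (z.1 i + 0) * (deriv θ (s * (z.1 i + 0)) * (s * 1))) 0 := by
      have h1 : HasDerivAt (fun t : ℝ => z.1 i + t) 1 0 := (hasDerivAt_id (0 : ℝ)).const_add _
      exact h1.mul ((hθd _).comp (0 : ℝ) (h1.const_mul s))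
    simp only [_root_.lineDeriv, hline, hd.deriv]
    ring_nf

/-- Functions annihilated by the Euler operator over `Ω` are total divergences over `Ω`. -/
lemma IsSmoothJetFun.exists_totalDiv_of_euler_eq_zero (hp : 0 < p) {Ω : Set (Base p)}
    {G : JetInf p q → ℝ} (hG : IsSmoothJetFun G)
    (hE : ∀ (α : Fin q) (z : JetInf p q), z.1 ∈ Ω → euler α G z = 0) :
    ∃ P : Fin p → JetInf p q → ℝ, (∀ i, IsSmoothJetFun (P i)) ∧
      ∀ z : JetInf p q, z.1 ∈ Ω → G z = ∑ i, NonlocalLagrangian.totalD i (P i) z := by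
  obtain ⟨A, hAs, hAd, hA⟩ := hG.exists_first_variation
  choose N a ha hAa using hAd
  have hfam := fun i => isDominatedFamily_unitInterval (ha i)
  obtain ⟨C, hCs, hC⟩ := hG.exists_totalD_eq_zero_section ⟨0, hp⟩
  -- The Kronecker delta puts the primitive `C` of `G (x, 0)` into a single component of `P`.
  let c : Fin p → ℝ := fun j => if j = ⟨0, hp⟩ then 1 else 0
  have hQs := fun i => (hfam i).isSmoothJetFun_integral aestronglyMeasurable_id
  refine ⟨fun i z => (∫ s in Set.Ioc (0 : ℝ) 1, a i s (truncJet (N i) z)) + c i * C z,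
    fun i => (hQs i).add (hCs.const_mul _), fun z hz => ?_⟩
  have h1 : ∀ i, NonlocalLagrangian.totalD i (fun z =>
      (∫ s in Set.Ioc (0 : ℝ) 1, a i s (truncJet (N i) z)) + c i * C z) z =
      (∫ s in Set.Ioc (0 : ℝ) 1,
        NonlocalLagrangian.totalD i (fun z => a i s (truncJet (N i) z)) z) +
        c i * NonlocalLagrangian.totalD i C z := by
    intro i
    rw [(hQs i).totalD_add (hCs.const_mul _), hCs.totalD_const_mul,
      (hfam i).totalD_integral aestronglyMeasurable_id]
  simp only [h1, Finset.sum_add_distrib]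
  simp only [c, ite_mul, one_mul, zero_mul,
    Finset.sum_ite_eq', Finset.mem_univ, if_true, hC]
  rw [← integral_finsetSum _ fun i _ =>
    ((hfam i).totalD i).integrable aestronglyMeasurable_id z, ← sub_eq_iff_eq_add]
  have hone : scaleJet 1 z = z := by simp [scaleJet]
  obtain ⟨M, g, hg, rfl⟩ := id hG
  have hsc : ∀ s : ℝ, truncJet M (scaleJet s z) = truncJet M (z.1, 0) +
      s • truncJet M (0, z.2) := by
    intro s
    refine Prod.ext ?_ (funext fun J => ?_) <;> simp [scaleJet, truncJet]
  have hgd : Differentiable ℝ g := hg.differentiable (by simp)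
  have key := integral_unitInterval_eq_sub (f := fun s => g (truncJet M (scaleJet s z)))
    (f' := fun s => fderiv ℝ g (truncJet M (scaleJet s z)) (truncJet M (0, z.2)))
    (g := fun s => ∑ i, NonlocalLagrangian.totalD i (fun z => a i s (truncJet (N i) z)) z)
    (fun s => ?_) ?_ fun s hs => ?_
  · simpa only [hone] using key
  · refine (hgd _).hasFDerivAt.comp_hasDerivAt s ?_
    simp only [hsc]
    simpa using ((hasDerivAt_id s).smul_const (truncJet M ((0, z.2) : JetInf p q))).const_add
      (truncJet M (z.1, 0))
  · simp only [hsc]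
    have := hg.continuous_fderiv (by simp)
    fun_prop
  -- The first variation at `(x, su)` is taken along `(0, su)`, so it is `s` times the wanted
  -- derivative. Both sides carry this factor, and `s ≠ 0` on `Ioc 0 1`. The Euler term vanishes
  -- because the scaled jet still lies over `Ω`.
  · refine mul_left_cancel₀ hs.1.ne' ?_
    have h2 := hA (scaleJet s z)
    rw [Finset.sum_eq_zero fun α _ => by rw [hE α (scaleJet s z) hz, mul_zero], zero_add,
      lineDeriv_comp_truncJet (hgd _)] at h2
    have h3 : truncJet M (0, (scaleJet s z).2) = s • truncJet M ((0, z.2) : JetInf p q) := by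
      simp [scaleJet, truncJet]
      rfl
    rw [h3, map_smul, smul_eq_mul] at h2
    rw [h2, Finset.mul_sum]
    exact Finset.sum_congr rfl fun i _ =>
      (hAs i).totalD_scaleJet (contDiff_of_uncurry (ha i) s) (hAa i s) i z

/-! ### Null Lagrangians -/

/-- Openness matters because the field is uncontrolled outside `Ω`, while `partialBase` is a
derivative in the ambient space. -/
lemma contDiffOn_partialBase {Ω : Set (Base p)} (hΩ : IsOpen Ω) {f : Base p → ℝ}
    (hf : ContDiffOn ℝ ∞ f Ω) (i : Fin p) : ContDiffOn ℝ ∞ (partialBase i f) Ω := by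
  refine ((hf.fderiv_of_isOpen hΩ (m := ∞) (by simp)).clm_apply
    (contDiffOn_const (c := (Pi.single i 1 : Base p)))).congr fun x hx => ?_
  exact ((hf.contDiffAt (hΩ.mem_nhds hx)).differentiableAt (by simp)).lineDeriv_eq_fderiv

lemma continuousOn_truncJet_prolong {Ω : Set (Base p)} (hΩ : IsOpen Ω) {φ : Base p → Fin q → ℝ}
    (hφ : ContDiffOn ℝ ∞ φ Ω) (N : ℕ) :
    ContinuousOn (fun x => truncJet N (prolong φ x)) Ω := by
  refine continuousOn_id.prodMk (continuousOn_pi.2 fun J => continuousOn_pi.2 fun α => ?_)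
  exact (multiIterate_induction (S := fun f : Base p → ℝ => ContDiffOn ℝ ∞ f Ω)
    (fun i f hf => contDiffOn_partialBase hΩ hf i) J.1 (contDiffOn_pi.1 hφ α)).continuousOn

lemma contDiff_symmetrised {n m : ℕ} {L : Jet p q n × Jet p q m → ℝ} (hL : ContDiff ℝ ∞ L) :
    ContDiff ℝ ∞ (symmetrised L) := by
  have h1 := contDiff_restrictJet (p := p) (q := q) (le_max_left n m) (k := ∞)
  have h2 := contDiff_restrictJet (p := p) (q := q) (le_max_right n m) (k := ∞)
  exact (hL.comp ((h1.comp contDiff_fst).prodMk (h2.comp contDiff_snd))).add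
    (hL.comp ((h1.comp contDiff_snd).prodMk (h2.comp contDiff_fst)))

section Admissible

variable {n m : ℕ} {Ω : Set (Base p)} {L : Jet p q n × Jet p q m → ℝ} {φ : Base p → Fin q → ℝ}

lemma IsAdmissible.aestronglyMeasurable (hΩ : IsOpen Ω) (hφ : IsAdmissible Ω L φ) :
    AEStronglyMeasurable (fun x => truncJet (max n m) (prolong φ x)) (volume.restrict Ω) :=
  (continuousOn_truncJet_prolong hΩ hφ.smooth _).aestronglyMeasurable hΩ.measurableSet

lemma IsAdmissible.isDominatedFamily (hΩ : IsOpen Ω) (hL : ContDiff ℝ ∞ L)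
    (hφ : IsAdmissible Ω L φ) :
    IsDominatedFamily (volume.restrict Ω) (fun x => truncJet (max n m) (prolong φ x))
      (fun x => liftInf (symmetrised L) (prolong φ x)) := by
  refine ⟨max n m, fun e b => symmetrised L (e, b), contDiff_symmetrised hL, fun k K hK => ?_, rfl⟩
  obtain ⟨g, hg, hb⟩ := hφ.dominated k K hK
  exact ⟨g, hg, (ae_restrict_mem hΩ.measurableSet).mono hb⟩

lemma IsAdmissible.isSmoothJetFun_integral1 (hΩ : IsOpen Ω) (hL : ContDiff ℝ ∞ L)
    (hφ : IsAdmissible Ω L φ) : IsSmoothJetFun (integral1 Ω φ (liftInf (symmetrised L))) :=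
  (hφ.isDominatedFamily hΩ hL).isSmoothJetFun_integral (hφ.aestronglyMeasurable hΩ)

lemma IsAdmissible.euler_integral1 (hΩ : IsOpen Ω) (hL : ContDiff ℝ ∞ L)
    (hφ : IsAdmissible Ω L φ) (α : Fin q) (z : JetInf p q) :
    ∫ x in Ω, (euler1 α (liftInf L) z (prolong φ x) + euler2 α (liftInf L) (prolong φ x) z) =
      euler α (integral1 Ω φ (liftInf (symmetrised L))) z := by
  -- Only the sum `L₁₂ + L₂₁` is dominated, so the integral is never split: the Euler operator is
  -- separated into its two parts pointwise in `x`, where each summand is smooth.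
  refine Eq.trans (integral_congr_ae (Filter.Eventually.of_forall fun x => ?_))
    ((hφ.isDominatedFamily hΩ hL).euler_integral (hφ.aestronglyMeasurable hΩ) α z).symm
  have h1 : IsSmoothJetFun fun w => liftInf L w (prolong φ x) :=
    ⟨n, fun b => L (b, truncJet m (prolong φ x)), hL.comp (contDiff_id.prodMk contDiff_const), rfl⟩
  have h2 : IsSmoothJetFun fun w => liftInf L (prolong φ x) w :=
    ⟨m, fun b => L (truncJet n (prolong φ x), b), hL.comp (contDiff_const.prodMk contDiff_id), rfl⟩
  exact (add_comm _ _).trans (h2.euler_add h1 α z).symm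

end Admissible

lemma exists_common_rep {ι : Type*} [Fintype ι] {P : ι → JetInf p q → ℝ}
    (hP : ∀ i, IsSmoothJetFun (P i)) : ∃ (N : ℕ) (f : ι → Jet p q N → ℝ),
      (∀ i, ContDiff ℝ ∞ (f i)) ∧ ∀ i, P i = fun z => f i (truncJet N z) := by
  choose N f hf hPf using hP
  have hN : ∀ i, N i ≤ Finset.univ.sup N := fun i => Finset.le_sup (Finset.mem_univ i)
  exact ⟨Finset.univ.sup N, fun i b => f i (restrictJet (hN i) b),
    fun i => (hf i).comp (contDiff_restrictJet _), hPf⟩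

end NonlocalLagrangian

end

open NonlocalLagrangian
theorem mainTheorem1 (p q n m : ℕ) (hp : 0 < p) (Ω : Set (Base p)) (hΩ : IsOpen Ω)
    (L : Jet p q n × Jet p q m → ℝ) (hL : ContDiff ℝ ∞ L) :
    IsNullOn Ω L ↔
      ∀ φ : Base p → Fin q → ℝ, IsAdmissible Ω L φ →
        ∃ (N : ℕ) (P : Fin p → Jet p q N → ℝ),
          (∀ i, ContDiffOn ℝ ∞ (P i) {b | b.1 ∈ Ω}) ∧
          ∀ z : JetInf p q, z.1 ∈ Ω →
            integral1 Ω φ (liftInf (symmetrised L)) z = totalDiv (fun i w => P i (truncJet N w)) z := by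
  constructor
  · intro hnull φ hφ
    obtain ⟨P, hPs, hP⟩ := (hφ.isSmoothJetFun_integral1 hΩ hL).exists_totalDiv_of_euler_eq_zero hp
      (Ω := Ω) fun α z hz => (hφ.euler_integral1 hΩ hL α z).symm.trans (hnull φ hφ α z hz)
    obtain ⟨N, f, hf, hPf⟩ := exists_common_rep hPs
    refine ⟨N, f, fun i => (hf i).contDiffOn, fun z hz => ?_⟩
    simp only [hP z hz, totalDiv, hPf]
  · intro hdiv φ hφ α z hz
    obtain ⟨N, P, hPs, hP⟩ := hdiv φ hφ
    rw [hφ.euler_integral1 hΩ hL]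
    exact euler_eq_zero_of_eq_totalDiv hΩ hPs hP α z hz
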